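/- Let $F$ be a non-Archimedean local field of odd residue characteristic, let $D_F$ be the quaternion division algebra with center $F$ (that is, a central division algebra of dimension $4$ over $F$), and give the unit group $D_F^\times$ its natural topology as a topological group. Let $H^2$ denote continuous cohomology with trivial action of $D_F^\times$ on the coefficients, where $\mathbb{Z}/2\mathbb{Z}$ is discrete and $\mathbb{C}^\times$ has its usual topology. Then: (A) there is an isomorphism of groups $H^2(D_F^\times, \mathbb{Z}/2\mathbb{Z}) \cong \mathbb{Z}/2\mathbb{Z} \oplus \mathbb{Z}/2\mathbb{Z}$; (B) the subgroup $H^2(D_F^\times, \mathbb{C}^\times)[2] = \{a \in H^2(D_F^\times, \mathbb{C}^\times) : 2a = 0\}$ is isomorphic to $\mathbb{Z}/2\mathbb{Z}$. -/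

import Mathlib

open scoped ValuativeRel

universe v

/-- The universe lift of a topological additive group is a topological additive group. -/
instance ULift.isTopologicalAddGroup_of_type {A : Type} [AddCommGroup A] [TopologicalSpace A]
    [IsTopologicalAddGroup A] : IsTopologicalAddGroup (ULift.{v} A) where
  continuous_add := continuous_uliftUp.comp
    ((continuous_uliftDown.comp continuous_fst).add (continuous_uliftDown.comp continuous_snd))
  continuous_neg := continuous_uliftUp.comp continuous_uliftDown.neg

/-- The continuous cohomology group `H²(G, A)` of a topological group `G` with coefficients in a
topological abelian group `A` (written additively) on which `G` acts trivially. The lift of `A` to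
the universe of `G` only serves to fit the universe levels of `continuousCohomology`. -/
noncomputable abbrev contH2 (G : Type v) [Group G] [TopologicalSpace G] [IsTopologicalGroup G]
    (A : Type) [AddCommGroup A] [TopologicalSpace A] [IsTopologicalAddGroup A] : TopModuleCat ℤ :=
  continuousCohomology.{0, v, v} 2
    (TopRep.of (ContRepresentation.trivial ℤ G (ULift.{v} A)))

/-!
The valuation of the norm makes `D` a valued division ring with compact unit ball. Its principal
units `N` are an open compact normal subgroup of `Dˣ`, and their open normal subgroups of odd index
form a basis at `1`: as `2` is a unit, squaring is injective modulo congruence subgroups. The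
quotient `Q = Dˣ / N` is `⟨ζ, ϖ | ζ ^ n = 1, ϖ ζ = ζ ^ R ϖ⟩`, a semidirect product of `ℤ` and the
cyclic group of units of the residue field, whose order `n` is even. Averaging over `N` shows that
inflation `H²(Q, ℤ/2) → H²(Dˣ, ℤ/2)` is bijective.

A class on `Q` with coefficients in `A` is determined by the values in `A × A` of the two relators
on lifts of `ζ` and `ϖ` to the central extension; another lift of `ζ` changes them by
`(n z, z - R z)`. For `A = ℤ/2` this change vanishes, which gives `(ℤ/2)²`. Every 2-torsion class
with coefficients in `ℂˣ` comes from `±1` by Kummer theory. As `ℂˣ` is divisible, writing `n = d m`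
and `R = 1 + d l` with `l` and `m` coprime, a pair of relator values `(u, w)` is trivial in `ℂˣ` as
soon as `l u + m w` is, which leaves `ℤ/2`.
-/

open Topology Filter

section TopModuleCatHomology

open CategoryTheory Limits

variable {R : Type*} [Ring R] [TopologicalSpace R] (K : CochainComplex (TopModuleCat.{v} R) ℕ)
  (i : ℕ)

/-- The kernel of a differential, as a submodule with the subspace topology, is the object of
cycles of the complex. -/
noncomputable def kerIsoCycles : TopModuleCat.ker (K.d (i + 1) (i + 2)) ≅ K.cycles (i + 1) :=
  (TopModuleCat.isLimitKer _).conePointUniqueUpToIso (K.cyclesIsKernel (i + 1) (i + 2) (by simp))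

/-- The cycles modulo the image of the incoming differential, with the quotient topology, are the
homology of the complex. -/
noncomputable def cokerIsoHomology :
    TopModuleCat.coker (K.toCycles i (i + 1)) ≅ K.homology (i + 1) :=
  (TopModuleCat.isColimitCoker _).coconePointUniqueUpToIso
    (K.homologyIsCokernel i (i + 1) (by simp))

variable {K i} in
theorem iCycles_kerIsoCycles (x : (K.d (i + 1) (i + 2)).hom.ker) :
    (K.iCycles (i + 1)).hom ((kerIsoCycles K i).hom.hom x) = x.1 :=
  have h : (kerIsoCycles K i).hom ≫ K.iCycles (i + 1) = TopModuleCat.kerι _ :=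
    IsLimit.conePointUniqueUpToIso_hom_comp _ _ WalkingParallelPair.zero
  congr(TopModuleCat.Hom.hom $h x)

theorem iCycles_injective : Function.Injective (K.iCycles (i + 1)).hom := fun a b h => by
  have hsurj := (ConcreteCategory.bijective_of_isIso (kerIsoCycles K i).hom).2
  obtain ⟨a, rfl⟩ := hsurj a
  obtain ⟨b, rfl⟩ := hsurj b
  rw [Subtype.ext ((iCycles_kerIsoCycles a).symm.trans (h.trans (iCycles_kerIsoCycles b)))]

/-- The map sending a cocycle of positive degree to its homology class. -/
noncomputable def kerToHomology : (K.d (i + 1) (i + 2)).hom.ker →ₗ[R] K.homology (i + 1) :=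
  (cokerIsoHomology K i).hom.hom.toLinearMap ∘ₗ (TopModuleCat.cokerπ _).hom.toLinearMap ∘ₗ
    (kerIsoCycles K i).hom.hom.toLinearMap

theorem kerToHomology_surjective : Function.Surjective (kerToHomology K i) :=
  ((ConcreteCategory.bijective_of_isIso (cokerIsoHomology K i).hom).2.comp
    (TopModuleCat.cokerπ_surjective _)).comp
      (ConcreteCategory.bijective_of_isIso (kerIsoCycles K i).hom).2

variable {K i} in
theorem kerToHomology_eq_zero_iff (x : (K.d (i + 1) (i + 2)).hom.ker) :
    kerToHomology K i x = 0 ↔ ∃ y : K.X i, (K.d i (i + 1)).hom y = x.1 := by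
  have hd y : (K.iCycles (i + 1)).hom ((K.toCycles i (i + 1)).hom y) = (K.d i (i + 1)).hom y :=
    congr(TopModuleCat.Hom.hom $(K.toCycles_i i (i + 1)) y)
  change (cokerIsoHomology K i).hom.hom ((TopModuleCat.cokerπ _).hom _) = 0 ↔ _
  rw [map_eq_zero_iff _ (ConcreteCategory.bijective_of_isIso (cokerIsoHomology K i).hom).1,
    TopModuleCat.hom_cokerπ, Submodule.mkQ_apply, Submodule.Quotient.mk_eq_zero]
  refine exists_congr fun y => ?_
  rw [← (iCycles_injective K i).eq_iff]
  exact (hd y).congr_left.trans (iCycles_kerIsoCycles x).congr_right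

end TopModuleCatHomology

section Cocycles

variable {Q A B : Type*} [Group Q] [AddCommGroup A] [AddCommGroup B]

/-- Inhomogeneous 2-cocycles with values in `A`, on which `Q` acts trivially. They are curried, as
are all cochains that need not be continuous. -/
def IsTwoCocycle (c : Q → Q → A) : Prop :=
  ∀ g h k, c h k + c g (h * k) = c (g * h) k + c g h

/-- The coboundary of an inhomogeneous 1-cochain, for the trivial action on the coefficients. -/
def coboundary : (Q → A) →+ Q → Q → A where
  toFun b g h := b g + b h - b (g * h)
  map_zero' := by ext; simp
  map_add' a b := by
    ext
    simp only [Pi.add_apply]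
    abel

@[simp]
theorem coboundary_apply (b : Q → A) (g h : Q) : coboundary b g h = b g + b h - b (g * h) := rfl

/-- The cochain `c` is the coboundary of a 1-cochain. -/
def IsTwoCoboundary (c : Q → Q → A) : Prop :=
  ∃ b, c = coboundary b

theorem isTwoCocycle_coboundary (b : Q → A) : IsTwoCocycle (coboundary b) := fun g h k => by
  simp only [coboundary_apply, mul_assoc]
  abel

theorem IsTwoCocycle.one_left {c : Q → Q → A} (hc : IsTwoCocycle c) (g : Q) : c 1 g = c 1 1 := by
  simpa using hc 1 1 g

theorem IsTwoCocycle.one_right {c : Q → Q → A} (hc : IsTwoCocycle c) (g : Q) : c g 1 = c 1 1 := by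
  simpa using (hc g 1 1).symm

variable (Q A) in
/-- The group of inhomogeneous 2-cocycles of the abstract group `Q`. -/
def twoCocycles : AddSubgroup (Q → Q → A) where
  carrier := {c | IsTwoCocycle c}
  zero_mem' _ _ _ := by simp
  add_mem' {a b} ha hb g h k := by
    simp only [Pi.add_apply]
    rw [add_add_add_comm, ha, hb, add_add_add_comm]
  neg_mem' {a} ha g h k := by
    simp only [Pi.neg_apply]
    rw [← neg_add, ha, neg_add]

variable (Q) in
/-- The map induced on 2-cocycles by a homomorphism of coefficients. -/
def twoCocyclesMap (f : A →+ B) : twoCocycles Q A →+ twoCocycles Q B where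
  toFun c := ⟨fun g h => f (c.1 g h), fun g h k => by simpa using congrArg f (c.2 g h k)⟩
  map_zero' := Subtype.ext (funext₂ fun _ _ => map_zero f)
  map_add' _ _ := Subtype.ext (funext₂ fun _ _ => map_add f _ _)

end Cocycles

section ContinuousCocycles

variable (G A : Type*) [Group G] [TopologicalSpace G]
  [AddCommGroup A] [TopologicalSpace A] [IsTopologicalAddGroup A]

/-- The group of continuous inhomogeneous 2-cocycles. -/
def contTwoCocycles : AddSubgroup C(G × G, A) :=
  (twoCocycles G A).comap
    { toFun c g h := c (g, h)
      map_zero' := rfl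
      map_add' _ _ := rfl }

end ContinuousCocycles

section HomogeneousCochains

variable {G : Type v} [Group G] [TopologicalSpace G] [IsTopologicalGroup G]
  {A : Type} [AddCommGroup A] [TopologicalSpace A] [IsTopologicalAddGroup A]

open CategoryTheory ContRepresentation TopRep

variable (G A) in
/-- The complex of continuous homogeneous cochains computing `contH2 G A`. -/
noncomputable abbrev trivialCochains : CochainComplex (TopModuleCat.{v} ℤ) ℕ :=
  homogeneousCochains (TopRep.of (ContRepresentation.trivial ℤ G (ULift.{v} A)))

theorem trivialCochains_d_one_two (σ : (trivialCochains G A).X 1) (x y z : G) :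
    (((trivialCochains G A).d 1 2).hom σ).1 x y z = σ.1 y z - σ.1 x z + σ.1 x y := by
  rw [homogeneousCochains.d_apply]
  change σ.1 y z - (σ.1 x z - σ.1 x y) = _
  abel

theorem trivialCochains_d_two_three (σ : (trivialCochains G A).X 2) (w x y z : G) :
    (((trivialCochains G A).d 2 3).hom σ).1 w x y z =
      σ.1 x y z - σ.1 w y z + σ.1 w x z - σ.1 w x y := by
  rw [homogeneousCochains.d_apply]
  change σ.1 x y z - (σ.1 w y z - (σ.1 w x z - σ.1 w x y)) = _
  abel

theorem trivialCochains_one_ext {σ τ : (trivialCochains G A).X 1}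
    (h : ∀ x y, (σ.1 x y).down = (τ.1 x y).down) : σ = τ :=
  Subtype.ext (ContinuousMap.ext fun x => ContinuousMap.ext fun y => ULift.down_injective (h x y))

theorem trivialCochains_two_ext {σ τ : (trivialCochains G A).X 2}
    (h : ∀ x y z, (σ.1 x y z).down = (τ.1 x y z).down) : σ = τ :=
  Subtype.ext (ContinuousMap.ext fun x => ContinuousMap.ext fun y => ContinuousMap.ext fun z =>
    ULift.down_injective (h x y z))

theorem trivialCochains_one_smul (σ : (trivialCochains G A).X 1) (g x y : G) :
    σ.1 (g * x) (g * y) = σ.1 x y := by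
  have h : σ.1 (g⁻¹⁻¹ * x) (g⁻¹⁻¹ * y) = σ.1 x y := congr($(σ.2 g⁻¹) x y)
  rwa [inv_inv] at h

theorem trivialCochains_two_smul (σ : (trivialCochains G A).X 2) (g x y z : G) :
    σ.1 (g * x) (g * y) (g * z) = σ.1 x y z := by
  have h : σ.1 (g⁻¹⁻¹ * x) (g⁻¹⁻¹ * y) (g⁻¹⁻¹ * z) = σ.1 x y z := congr($(σ.2 g⁻¹) x y z)
  rwa [inv_inv] at h

/-- The homogeneous 1-cochain `(x, y) ↦ b (x⁻¹ y)` attached to an inhomogeneous one. -/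
def toHomogeneousOne (b : C(G, A)) : (trivialCochains G A).X 1 :=
  ⟨(ContinuousMap.mk (fun p : G × G => ULift.up (b (p.1⁻¹ * p.2)))
    (continuous_uliftUp.comp (by fun_prop))).curry, fun g => by
      ext x y
      change b ((g⁻¹ * x)⁻¹ * (g⁻¹ * y)) = b (x⁻¹ * y)
      congr 1; group⟩

/-- The homogeneous 2-cochain `(x, y, z) ↦ c (x⁻¹ y, y⁻¹ z)` attached to an inhomogeneous one. -/
def toHomogeneousTwo (c : C(G × G, A)) : (trivialCochains G A).X 2 :=
  ⟨(ContinuousMap.mk (fun p : (G × G) × G => ULift.up (c (p.1.1⁻¹ * p.1.2, p.1.2⁻¹ * p.2)))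
    (continuous_uliftUp.comp (by fun_prop))).curry.curry, fun g => by
      ext x y z
      change c ((g⁻¹ * x)⁻¹ * (g⁻¹ * y), (g⁻¹ * y)⁻¹ * (g⁻¹ * z)) = c (x⁻¹ * y, y⁻¹ * z)
      congr 2 <;> group⟩

theorem toHomogeneousOne_surjective :
    Function.Surjective (toHomogeneousOne : C(G, A) → (trivialCochains G A).X 1) := fun σ => by
  refine ⟨⟨fun g => (σ.1 1 g).down, continuous_uliftDown.comp (σ.1 1).continuous⟩,
    trivialCochains_one_ext fun x y => congrArg ULift.down ?_⟩
  change σ.1 1 (x⁻¹ * y) = σ.1 x y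
  rw [← trivialCochains_one_smul σ x, mul_one, mul_inv_cancel_left]

theorem toHomogeneousTwo_surjective [LocallyCompactSpace G] :
    Function.Surjective (toHomogeneousTwo : C(G × G, A) → (trivialCochains G A).X 2) := fun σ => by
  let τ : C(G, C(G, ULift.{v} A)) := σ.1 1
  have hτ : Continuous fun p : G × G => τ p.1 (p.1 * p.2) :=
    (ContinuousEval.continuous_eval (F := C(G, ULift.{v} A))).comp
      ((τ.continuous.comp continuous_fst).prodMk (by fun_prop))
  refine ⟨⟨_, continuous_uliftDown.comp hτ⟩,
    trivialCochains_two_ext fun x y z => congrArg ULift.down ?_⟩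
  change σ.1 1 (x⁻¹ * y) (x⁻¹ * y * (y⁻¹ * z)) = σ.1 x y z
  rw [← trivialCochains_two_smul σ x, mul_one, mul_inv_cancel_left, mul_assoc,
    mul_inv_cancel_left, mul_inv_cancel_left]

theorem d_toHomogeneousOne_eq_iff (b : C(G, A)) (c : C(G × G, A)) :
    ((trivialCochains G A).d 1 2).hom (toHomogeneousOne b) = toHomogeneousTwo c ↔
      ∀ g h, c (g, h) = coboundary b g h := by
  refine ⟨fun hbc g h => ?_, fun hbc => trivialCochains_two_ext fun x y z => ?_⟩
  · have hd := trivialCochains_d_one_two (toHomogeneousOne b) 1 g (g * h)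
    rw [hbc] at hd
    replace hd : c (1⁻¹ * g, g⁻¹ * (g * h)) =
      b (g⁻¹ * (g * h)) - b (1⁻¹ * (g * h)) + b (1⁻¹ * g) := congrArg ULift.down hd
    simp only [inv_mul_cancel_left, inv_one, one_mul] at hd
    rw [hd, coboundary_apply]
    abel
  · rw [trivialCochains_d_one_two]
    change b (y⁻¹ * z) - b (x⁻¹ * z) + b (x⁻¹ * y) = c (x⁻¹ * y, y⁻¹ * z)
    rw [hbc, coboundary_apply, mul_assoc, mul_inv_cancel_left]
    abel

theorem d_toHomogeneousTwo_eq_zero_iff (c : C(G × G, A)) :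
    ((trivialCochains G A).d 2 3).hom (toHomogeneousTwo c) = 0 ↔ c ∈ contTwoCocycles G A := by
  refine ⟨fun hc g h k => ?_, fun hc => Subtype.ext (ContinuousMap.ext fun w =>
    ContinuousMap.ext fun x => ContinuousMap.ext fun y => ContinuousMap.ext fun z =>
      ULift.down_injective ?_)⟩
  · have hd := trivialCochains_d_two_three (toHomogeneousTwo c) 1 g (g * h) (g * h * k)
    rw [hc] at hd
    replace hd : 0 = c (_, _) - c (_, _) + c (_, _) - c (_, _) := congrArg ULift.down hd
    simp only [inv_mul_cancel_left, inv_one, one_mul, mul_assoc, mul_inv_rev] at hd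
    change c (h, k) + c (g, h * k) = c (g * h, k) + c (g, h)
    rw [← sub_eq_zero, hd]
    abel
  · rw [trivialCochains_d_two_three]
    have hcocycle : c (x⁻¹ * y, y⁻¹ * z) + c (w⁻¹ * x, _) = c (w⁻¹ * x * _, y⁻¹ * z) + c (_, _) :=
      hc (w⁻¹ * x) (x⁻¹ * y) (y⁻¹ * z)
    simp only [mul_assoc, mul_inv_cancel_left] at hcocycle
    change c (x⁻¹ * y, y⁻¹ * z) - c (w⁻¹ * y, y⁻¹ * z) + c (w⁻¹ * x, x⁻¹ * z) -
      c (w⁻¹ * x, x⁻¹ * y) = 0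
    rw [sub_eq_zero, sub_add_eq_add_sub, hcocycle]
    abel

end HomogeneousCochains

namespace contH2

variable {G : Type v} [Group G] [TopologicalSpace G] [IsTopologicalGroup G]
  {A : Type} [AddCommGroup A] [TopologicalSpace A] [IsTopologicalAddGroup A]

/-- The class in `contH2 G A` of a continuous inhomogeneous 2-cocycle. -/
noncomputable def mk : contTwoCocycles G A →+ contH2 G A :=
  (kerToHomology (trivialCochains G A) 1).toAddMonoidHom.comp
    { toFun c := ⟨toHomogeneousTwo c.1, (d_toHomogeneousTwo_eq_zero_iff c.1).2 c.2⟩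
      map_zero' := rfl
      map_add' _ _ := rfl }

theorem mk_surjective [LocallyCompactSpace G] :
    Function.Surjective (mk : contTwoCocycles G A →+ contH2 G A) :=
  (kerToHomology_surjective _ 1).comp fun x => by
    obtain ⟨c, hc⟩ := toHomogeneousTwo_surjective x.1
    exact ⟨⟨c, (d_toHomogeneousTwo_eq_zero_iff c).1 (hc ▸ x.2)⟩, Subtype.ext hc⟩

theorem mk_eq_zero_iff (c : contTwoCocycles G A) :
    mk c = 0 ↔ ∃ b : C(G, A), ∀ g h, c.1 (g, h) = coboundary b g h :=
  (kerToHomology_eq_zero_iff _).trans <| toHomogeneousOne_surjective.exists.trans <|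
    exists_congr fun b => d_toHomogeneousOne_eq_iff b c.1

end contH2

section CentralExtension

variable {Q A : Type*} [Group Q] [AddCommGroup A]

/-- The central extension of `Q` by `A` defined by a 2-cocycle `c`: the set `A × Q` with
multiplication `(x, g) (y, h) = (x + y + c g h, g h)`. The cocycle need not be normalized, so the
identity is `(-c 1 1, 1)`. -/
@[ext]
structure CentralExtension {c : Q → Q → A} (hc : IsTwoCocycle c) where
  fst : A
  snd : Q

namespace CentralExtension

variable {c : Q → Q → A} {hc : IsTwoCocycle c}

instance : Mul (CentralExtension hc) := ⟨fun x y => ⟨x.1 + y.1 + c x.2 y.2, x.2 * y.2⟩⟩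
instance : One (CentralExtension hc) := ⟨⟨-c 1 1, 1⟩⟩
instance : Inv (CentralExtension hc) := ⟨fun x => ⟨-x.1 - c x.2⁻¹ x.2 - c 1 1, x.2⁻¹⟩⟩

@[simp] theorem mul_fst (x y : CentralExtension hc) : (x * y).1 = x.1 + y.1 + c x.2 y.2 := rfl
@[simp] theorem mul_snd (x y : CentralExtension hc) : (x * y).2 = x.2 * y.2 := rfl
@[simp] theorem one_fst : (1 : CentralExtension hc).1 = -c 1 1 := rfl
@[simp] theorem one_snd : (1 : CentralExtension hc).2 = 1 := rfl
@[simp] theorem inv_fst (x : CentralExtension hc) : x⁻¹.1 = -x.1 - c x.2⁻¹ x.2 - c 1 1 := rfl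
@[simp] theorem inv_snd (x : CentralExtension hc) : x⁻¹.2 = x.2⁻¹ := rfl

instance : Group (CentralExtension hc) :=
  Group.ofLeftAxioms
    (fun x y z => by
      ext
      · calc x.1 + y.1 + c x.2 y.2 + z.1 + c (x.2 * y.2) z.2
            = x.1 + y.1 + z.1 + (c (x.2 * y.2) z.2 + c x.2 y.2) := by abel
          _ = x.1 + (y.1 + z.1 + c y.2 z.2) + c x.2 (y.2 * z.2) := by rw [← hc]; abel
      · exact mul_assoc _ _ _)
    (fun x => by ext <;> simp [hc.one_left])
    (fun x => by ext <;> simp; abel)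

variable (hc) in
/-- The projection of a central extension onto its quotient. -/
def proj : CentralExtension hc →* Q where
  toFun := snd
  map_one' := rfl
  map_mul' _ _ := rfl

theorem isTwoCoboundary_of_section (s : Q →* CentralExtension hc)
    (hs : (proj hc).comp s = MonoidHom.id Q) : IsTwoCoboundary c := by
  refine ⟨fun g => -(s g).1, funext₂ fun g h => ?_⟩
  have hs' (q : Q) : (s q).2 = q := DFunLike.congr_fun hs q
  have hmul := congr(($(s.map_mul g h)).1)
  rw [mul_fst, hs', hs'] at hmul
  rw [coboundary_apply, hmul]
  abel

theorem mk_pow (x : A) (g : Q) (k : ℕ) :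
    (⟨x, g⟩ ^ k : CentralExtension hc) =
      ⟨k • x - c 1 1 + ∑ i ∈ Finset.range k, c (g ^ i) g, g ^ k⟩ := by
  induction k with
  | zero => ext <;> simp
  | succ k ih =>
    rw [pow_succ, ih, Finset.sum_range_succ]
    ext
    · simp only [mul_fst, succ_nsmul]
      abel
    · simp [pow_succ]

end CentralExtension

theorem sum_coboundary_pow (b : Q → A) (g : Q) (k : ℕ) :
    ∑ i ∈ Finset.range k, coboundary b (g ^ i) g = k • b g + b 1 - b (g ^ k) := by
  induction k with
  | zero => simp
  | succ k ih =>
    rw [Finset.sum_range_succ, ih, coboundary_apply, succ_nsmul, pow_succ]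
    abel

end CentralExtension

section CyclicByInt

open Multiplicative SemidirectProduct

theorem semiconj_of_semiconj_ofAdd_one {M N : Type*} [Mul M] [Mul N] {f : M → N}
    {α : Multiplicative ℤ →* MulAut M} {β : Multiplicative ℤ →* MulAut N}
    (h : Function.Semiconj f (α (ofAdd 1)) (β (ofAdd 1))) (v : Multiplicative ℤ) :
    Function.Semiconj f (α v) (β v) := by
  have hv : v = ofAdd (1 : ℤ) ^ toAdd v := by rw [← ofAdd_zsmul]; simp
  rw [hv, map_zpow, map_zpow]
  induction toAdd v using Int.induction_on with
  | zero => exact Function.Semiconj.id_right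
  | succ s ih =>
    rw [zpow_add_one, zpow_add_one]
    exact ih.comp_right h
  | pred s ih =>
    rw [zpow_sub_one, zpow_sub_one]
    exact ih.comp_right
      (h.inverses_right (MulEquiv.apply_symm_apply _) (MulEquiv.symm_apply_apply _))

/-- The action of `ℤ` on `ℤ/n` in which `1` acts as multiplication by the unit `r`. -/
def intAction {n : ℕ} (r : (ZMod n)ˣ) : Multiplicative ℤ →* MulAut (Multiplicative (ZMod n)) :=
  ((MulAutMultiplicative (ZMod n)).symm.toMonoidHom.comp AddAut.mulLeft).comp (zpowersHom _ r)

theorem toAdd_intAction {n : ℕ} (r : (ZMod n)ˣ) (v : Multiplicative ℤ)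
    (e : Multiplicative (ZMod n)) : toAdd (intAction r v e) = ↑(r ^ toAdd v) * toAdd e := rfl

/-- The semidirect product of `ℤ` acting on `ℤ/n` by powers of the unit `r`; the quotient of the
unit group of a local division algebra by its principal units has this shape. -/
abbrev CyclicByInt (n : ℕ) (r : (ZMod n)ˣ) :=
  Multiplicative (ZMod n) ⋊[intAction r] Multiplicative ℤ

namespace CyclicByInt

variable {n : ℕ} {r : (ZMod n)ˣ}

variable (n r) in
/-- The generator of the cyclic normal subgroup. -/
def ζ : CyclicByInt n r := inl (ofAdd 1)

variable (n r) in
/-- The generator of the infinite cyclic complement. -/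
def ϖ : CyclicByInt n r := inr (ofAdd 1)

theorem ζ_pow (k : ℕ) : ζ n r ^ k = inl (ofAdd (k : ZMod n)) := by
  rw [ζ, ← map_pow, ← ofAdd_nsmul, nsmul_one]

theorem ζ_pow_self : ζ n r ^ n = 1 := by
  rw [ζ_pow, ZMod.natCast_self, ofAdd_zero, map_one]

theorem ϖ_mul_ζ {R : ℕ} (hR : (R : ZMod n) = r) : ϖ n r * ζ n r = ζ n r ^ R * ϖ n r := by
  have hconj : inr (ofAdd 1) * ζ n r * inr (ofAdd 1)⁻¹ = inl (ofAdd (R : ZMod n)) := by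
    rw [ζ, ← inl_aut, inl_inj]
    apply toAdd.injective
    simp [toAdd_intAction, hR]
  rw [ζ_pow, ← hconj, map_inv, ϖ, inv_mul_cancel_right]

theorem hom_ext {E : Type*} [Group E] {φ ψ : CyclicByInt n r →* E} (hζ : φ (ζ n r) = ψ (ζ n r))
    (hϖ : φ (ϖ n r) = ψ (ϖ n r)) : φ = ψ := by
  refine SemidirectProduct.hom_ext (MonoidHom.ext fun x => ?_) (MonoidHom.ext_mint hϖ)
  obtain ⟨k, hk⟩ := ZMod.intCast_surjective (toAdd x)
  have hx : inl x = ζ n r ^ k := by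
    rw [ζ, ← map_zpow, ← ofAdd_zsmul, zsmul_one, hk, ofAdd_toAdd]
  simp only [MonoidHom.comp_apply, hx, map_zpow, hζ]

theorem exists_hom {E : Type*} [Group E] {R : ℕ} (hR : (R : ZMod n) = r) {Z W : E}
    (hZ : Z ^ n = 1) (hW : W * Z = Z ^ R * W) :
    ∃ φ : CyclicByInt n r →* E, φ (ζ n r) = Z ∧ φ (ϖ n r) = W := by
  let F : ZMod n →+ Additive E := ZMod.lift n ⟨zmultiplesHom _ (Additive.ofMul Z), by
    simpa [zmultiplesHom_apply] using congrArg Additive.ofMul hZ⟩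
  let f : Multiplicative (ZMod n) →* E := F.toMultiplicativeLeft
  have f_intCast (k : ℤ) : f (ofAdd k) = Z ^ k := by
    change (F k).toMul = _
    rw [ZMod.lift_coe, zmultiplesHom_apply, toMul_zsmul, toMul_ofMul]
  have hconj : Function.Semiconj f (intAction r (ofAdd 1))
      (MulAut.conj.comp (zpowersHom E W) (ofAdd 1)) := fun x => by
    obtain ⟨k, hk⟩ := ZMod.intCast_surjective (toAdd x)
    have hx : intAction r (ofAdd 1) x = ofAdd (((R * k : ℤ) : ZMod n)) := by
      apply toAdd.injective
      rw [toAdd_intAction, ← hk, toAdd_ofAdd, toAdd_ofAdd, zpow_one]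
      push_cast
      rw [hR]
    have hZR : W * Z * W⁻¹ = Z ^ R := by rw [hW, mul_inv_cancel_right]
    have hfx : f x = Z ^ k := by rw [← f_intCast, hk, ofAdd_toAdd]
    rw [hx, f_intCast, hfx, zpow_mul, zpow_natCast, ← hZR, conj_zpow]
    simp
  refine ⟨lift f (zpowersHom E W) fun v => MonoidHom.ext (semiconj_of_semiconj_ofAdd_one hconj v),
    ?_, ?_⟩
  · rw [ζ, lift_inl]
    simpa using f_intCast 1
  · rw [ϖ, lift_inr]
    simp

variable {A B : Type*} [AddCommGroup A] [AddCommGroup B]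

/-- The value of `Z ^ n` for a lift `Z` of `ζ` to the central extension defined by the cocycle `c`,
up to `n`-th multiples. -/
def torsionInvariant (n : ℕ) (r : (ZMod n)ˣ) (c : CyclicByInt n r → CyclicByInt n r → A) : A :=
  ∑ i ∈ Finset.range n, c (ζ n r ^ i) (ζ n r)

/-- The quotient of `W * Z` by `Z ^ R * W` for lifts `Z`, `W` of `ζ`, `ϖ` to the central extension
defined by the cocycle `c`; here `R` is a natural number representing `r`. -/
def commutatorInvariant (n : ℕ) (r : (ZMod n)ˣ) (R : ℕ)
    (c : CyclicByInt n r → CyclicByInt n r → A) : A :=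
  c (ϖ n r) (ζ n r) - c (ζ n r ^ R) (ϖ n r) - ∑ i ∈ Finset.range R, c (ζ n r ^ i) (ζ n r) + c 1 1

/-- The two relators of the presentation `⟨ζ, ϖ | ζ ^ n = 1, ϖ ζ = ζ ^ R ϖ⟩`, evaluated in the
central extension defined by a cocycle. -/
def invariants (n : ℕ) (r : (ZMod n)ˣ) (R : ℕ) (A : Type*) [AddCommGroup A] :
    (CyclicByInt n r → CyclicByInt n r → A) →+ A × A :=
  AddMonoidHom.mk' (fun c => (torsionInvariant n r c, commutatorInvariant n r R c)) fun c d => by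
    ext
    · simp only [torsionInvariant, Pi.add_apply, Prod.fst_add, Finset.sum_add_distrib]
    · simp only [commutatorInvariant, Pi.add_apply, Prod.snd_add, Finset.sum_add_distrib]
      abel

theorem invariants_comp (f : A →+ B) (R : ℕ) (c : CyclicByInt n r → CyclicByInt n r → A) :
    invariants n r R B (fun g h => f (c g h)) = f.prodMap f (invariants n r R A c) :=
  Prod.ext (map_sum f (fun i => c (ζ n r ^ i) (ζ n r)) (Finset.range n)).symm
    (by simp [invariants, commutatorInvariant])

theorem isTwoCoboundary_iff {c : CyclicByInt n r → CyclicByInt n r → A} (hc : IsTwoCocycle c)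
    {R : ℕ} (hR : (R : ZMod n) = r) :
    IsTwoCoboundary c ↔ ∃ z : A, invariants n r R A c = (n • z, z - R • z) := by
  constructor
  · rintro ⟨b, rfl⟩
    refine ⟨b (ζ n r), Prod.ext ?_ ?_⟩
    · change torsionInvariant n r (coboundary b) = n • b (ζ n r)
      rw [torsionInvariant, sum_coboundary_pow, ζ_pow_self, add_sub_cancel_right]
    · change commutatorInvariant n r R (coboundary b) = b (ζ n r) - R • b (ζ n r)
      rw [commutatorInvariant, sum_coboundary_pow]
      simp only [coboundary_apply, ϖ_mul_ζ hR, mul_one]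
      abel
  · rintro ⟨z, hz⟩
    obtain ⟨hZ, hW⟩ : torsionInvariant n r c = n • z ∧ commutatorInvariant n r R c = z - R • z :=
      Prod.ext_iff.1 hz
    let Z : CentralExtension hc := ⟨-z, ζ n r⟩
    let W : CentralExtension hc := ⟨0, ϖ n r⟩
    have hZ' : Z ^ n = 1 := by
      rw [CentralExtension.mk_pow]
      ext1
      · change _ - _ + torsionInvariant n r c = -c 1 1
        rw [hZ, smul_neg]
        abel
      · exact ζ_pow_self
    have hW' : W * Z = Z ^ R * W := by
      rw [CentralExtension.mk_pow]
      ext1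
      · change 0 + -z + c (ϖ n r) (ζ n r) = _ - _ + _ + 0 + c (ζ n r ^ R) (ϖ n r)
        rw [← sub_eq_zero, commutatorInvariant] at hW
        rw [← sub_eq_zero, ← hW, smul_neg]
        abel
      · exact ϖ_mul_ζ hR
    obtain ⟨φ, hφζ, hφϖ⟩ := exists_hom hR hZ' hW'
    exact CentralExtension.isTwoCoboundary_of_section φ
      (hom_ext (congrArg (CentralExtension.proj hc) hφζ) (congrArg (CentralExtension.proj hc) hφϖ))

section ExistsCocycle

variable {k : ℕ}

theorem castHom_units_zpow {m k : ℕ} {u : (ZMod m)ˣ} (hkm : k ∣ m) (hu : ZMod.unitsMap hkm u = 1)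
    (s : ℤ) : ZMod.castHom hkm (ZMod k) ↑(u ^ s) = 1 :=
  congrArg Units.val (show ZMod.unitsMap hkm (u ^ s) = 1 by rw [map_zpow, hu, one_zpow])

/-- The cup product of the two characters `g ↦ g.right` and `g ↦ g.left mod k` detects the
commutator invariant. -/
theorem exists_cocycle_commutatorInvariant (hkn : k ∣ n) (hr : ZMod.unitsMap hkn r = 1) (R : ℕ) :
    ∃ c : CyclicByInt n r → CyclicByInt n r → ZMod k, IsTwoCocycle c ∧
      torsionInvariant n r c = 0 ∧ commutatorInvariant n r R c = 1 := by
  let χ (g : CyclicByInt n r) : ZMod k := ZMod.castHom hkn (ZMod k) (toAdd g.left)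
  have χ_mul (g h) : χ (g * h) = χ g + χ h := by
    simp only [χ, mul_left, toAdd_mul, toAdd_intAction, map_add, map_mul,
      castHom_units_zpow hkn hr, one_mul]
  have χ_ζ : χ (ζ n r) = 1 := map_one _
  have χ_ϖ : χ (ϖ n r) = 0 := map_zero _
  have χ_one : χ 1 = 0 := map_zero _
  refine ⟨fun g h => toAdd g.right * χ h, fun g h l => ?_, ?_, ?_⟩
  · simp only [χ_mul, mul_right, toAdd_mul, Int.cast_add]
    ring
  · simp [torsionInvariant, ζ_pow]
  · simp [commutatorInvariant, ζ_pow, χ_ζ, χ_ϖ, χ_one, show (ϖ n r).right = ofAdd 1 from rfl]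

section Carry

/-- Multiplication by `n`, as an embedding of `ℤ/k` into `ℤ/kn`. -/
def mulEmbedding (k n : ℕ) : ZMod k →+ ZMod (k * n) :=
  ZMod.lift k ⟨zmultiplesHom _ (n : ZMod (k * n)), by
    rw [zmultiplesHom_apply, zsmul_eq_mul, Int.cast_natCast, ← Nat.cast_mul, ZMod.natCast_self]⟩

theorem mulEmbedding_intCast (m : ℤ) : mulEmbedding k n m = m * n := by
  simp [mulEmbedding]

theorem mulEmbedding_injective (hn : n ≠ 0) : Function.Injective (mulEmbedding k n) := by
  rw [injective_iff_map_eq_zero]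
  intro a ha
  obtain ⟨m, rfl⟩ := ZMod.intCast_surjective a
  rw [mulEmbedding_intCast, ← Int.cast_natCast n, ← Int.cast_mul,
    ZMod.intCast_zmod_eq_zero_iff_dvd, Nat.cast_mul] at ha
  rw [ZMod.intCast_zmod_eq_zero_iff_dvd]
  exact Int.dvd_of_mul_dvd_mul_right (by exact_mod_cast hn) ha

theorem exists_mulEmbedding_eq {x : ZMod (k * n)}
    (hx : ZMod.castHom (Dvd.intro_left k rfl) (ZMod n) x = 0) : ∃ y, mulEmbedding k n y = x := by
  obtain ⟨m, rfl⟩ := ZMod.intCast_surjective x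
  rw [map_intCast, ZMod.intCast_zmod_eq_zero_iff_dvd] at hx
  obtain ⟨t, rfl⟩ := hx
  exact ⟨t, by rw [mulEmbedding_intCast]; push_cast; ring⟩

theorem mul_mulEmbedding (x : ZMod (k * n)) (y : ZMod k) :
    x * mulEmbedding k n y = mulEmbedding k n (ZMod.castHom (Dvd.intro n rfl) (ZMod k) x * y) := by
  obtain ⟨l, rfl⟩ := ZMod.intCast_surjective x
  obtain ⟨m, rfl⟩ := ZMod.intCast_surjective y
  rw [mulEmbedding_intCast, map_intCast (ZMod.castHom (Dvd.intro n rfl) (ZMod k)), ← Int.cast_mul,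
    mulEmbedding_intCast]
  push_cast
  ring

end Carry

/-- The cocycle is the twisted carry of the addition in `ℤ/n`; its central extension is the
analogous semidirect product `ℤ/kn ⋊ ℤ`. -/
theorem exists_carryCocycle (hn : n ≠ 0) (hkn : k ∣ n) (hr : ZMod.unitsMap hkn r = 1) :
    ∃ (u : (ZMod (k * n))ˣ) (c : CyclicByInt n r → CyclicByInt n r → ZMod k), IsTwoCocycle c ∧
      ∀ g h, mulEmbedding k n (c g h) = ((toAdd g.left).val : ZMod (k * n)) +
        ↑(u ^ toAdd g.right) * (toAdd h.left).val - (toAdd (g * h).left).val := by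
  have : NeZero n := ⟨hn⟩
  have : NeZero (k * n) := ⟨mul_ne_zero (ne_zero_of_dvd_ne_zero hn hkn) hn⟩
  have hnkn : n ∣ k * n := Dvd.intro_left k rfl
  obtain ⟨u, hu⟩ := ZMod.unitsMap_surjective hnkn r
  have hu_one : ZMod.unitsMap (Dvd.intro n rfl : k ∣ k * n) u = 1 := by
    rw [← hr, ← hu, ← MonoidHom.comp_apply, ZMod.unitsMap_comp]
  have hpu (s : ℤ) : ZMod.castHom hnkn (ZMod n) ↑(u ^ s) = ↑(r ^ s) := by
    rw [← hu, ← map_zpow]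
    rfl
  have hcarry (g h : CyclicByInt n r) : ∃ y : ZMod k, mulEmbedding k n y =
      ((toAdd g.left).val : ZMod (k * n)) + ↑(u ^ toAdd g.right) * (toAdd h.left).val -
        (toAdd (g * h).left).val := by
    refine exists_mulEmbedding_eq ?_
    rw [map_sub, map_add, map_mul, hpu, mul_left, toAdd_mul, toAdd_intAction]
    simp only [map_natCast, ZMod.natCast_zmod_val, sub_self]
  choose c hc using hcarry
  refine ⟨u, c, fun g h m => mulEmbedding_injective hn ?_, hc⟩
  have hsmul : mulEmbedding k n (c h m) = ↑(u ^ toAdd g.right) * mulEmbedding k n (c h m) := by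
    rw [mul_mulEmbedding, castHom_units_zpow _ hu_one, one_mul]
  rw [map_add, map_add, hsmul, hc, hc, hc, hc, mul_right, toAdd_mul, zpow_add, Units.val_mul,
    mul_assoc g h m]
  ring

theorem exists_cocycle_torsionInvariant (hn : n ≠ 0) (hkn : k ∣ n)
    (hr : ZMod.unitsMap hkn r = 1) :
    ∃ c : CyclicByInt n r → CyclicByInt n r → ZMod k, IsTwoCocycle c ∧
      torsionInvariant n r c = 1 := by
  have : NeZero n := ⟨hn⟩
  obtain ⟨u, c, hc, hcarry⟩ := exists_carryCocycle hn hkn hr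
  let l (g : CyclicByInt n r) : ZMod (k * n) := ((toAdd g.left).val : ZMod (k * n))
  have hcζ (i : ℕ) : mulEmbedding k n (c (ζ n r ^ i) (ζ n r)) =
      coboundary l (ζ n r ^ i) (ζ n r) := by
    have hright : (ζ n r ^ i).right = 1 := by rw [ζ_pow, right_inl]
    rw [hcarry, coboundary_apply, hright, toAdd_one, zpow_zero, Units.val_one, one_mul]
  have hsum : mulEmbedding k n (torsionInvariant n r c) = n * l (ζ n r) := by
    rw [torsionInvariant, map_sum, Finset.sum_congr rfl fun i _ => hcζ i, sum_coboundary_pow,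
      ζ_pow_self, add_sub_cancel_right, nsmul_eq_mul]
  obtain ⟨y, hy⟩ : ∃ y, mulEmbedding k n y = l (ζ n r) - 1 :=
    exists_mulEmbedding_eq <| by
      simp only [l, ζ, left_inl, toAdd_ofAdd, map_sub, map_one, map_natCast,
        ZMod.natCast_zmod_val, sub_self]
  have hny : (n : ZMod (k * n)) * mulEmbedding k n y = 0 := by
    rw [mul_mulEmbedding, map_natCast, (ZMod.natCast_eq_zero_iff n k).2 hkn, zero_mul, map_zero]
  have hone : mulEmbedding k n 1 = n := by simpa using mulEmbedding_intCast (k := k) (n := n) 1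
  refine ⟨c, hc, mulEmbedding_injective hn ?_⟩
  rw [hsum, hone, ← sub_eq_zero, ← hny, hy]
  ring

theorem exists_cocycle_invariants_eq (hn : n ≠ 0) (hkn : k ∣ n) (hr : ZMod.unitsMap hkn r = 1)
    (R : ℕ) (x : ZMod k × ZMod k) :
    ∃ c : twoCocycles (CyclicByInt n r) (ZMod k), invariants n r R (ZMod k) c = x := by
  obtain ⟨c, hc, hca⟩ := exists_cocycle_torsionInvariant hn hkn hr
  obtain ⟨d, hd, hda, hdb⟩ := exists_cocycle_commutatorInvariant hkn hr R
  obtain ⟨a, ha⟩ := ZMod.intCast_surjective x.1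
  obtain ⟨t, ht⟩ := ZMod.intCast_surjective (x.2 - x.1 * commutatorInvariant n r R c)
  refine ⟨a • ⟨c, hc⟩ + t • ⟨d, hd⟩, ?_⟩
  have hinv_c : invariants n r R (ZMod k) c = (1, commutatorInvariant n r R c) :=
    Prod.ext hca rfl
  have hinv_d : invariants n r R (ZMod k) d = (0, 1) := Prod.ext hda hdb
  simp only [AddSubgroup.coe_add, AddSubgroup.coe_zsmul, map_add, map_zsmul, hinv_c, hinv_d]
  ext
  · simp [ha]
  · simp [ha, ht]

end ExistsCocycle

end CyclicByInt

end CyclicByInt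

section CosetAverage

variable {k : ℕ} {N : Type*} [Group N]

/-- The average over `N ⧸ V` of the values of a function at the chosen representatives. -/
noncomputable def cosetAverage (k : ℕ) (V : Subgroup N) (f : N → ZMod k) : ZMod k :=
  (V.index : ZMod k)⁻¹ * ∑ᶠ q : N ⧸ V, f q.out

theorem cosetAverage_add (V : Subgroup N) [Finite (N ⧸ V)] (f g : N → ZMod k) :
    cosetAverage k V (f + g) = cosetAverage k V f + cosetAverage k V g := by
  rw [cosetAverage, cosetAverage, cosetAverage, ← mul_add,
    ← finsum_add_distrib (Set.toFinite _) (Set.toFinite _)]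
  rfl

theorem cosetAverage_const {V : Subgroup N} [Finite (N ⧸ V)] (hV : k.Coprime V.index)
    (a : ZMod k) : cosetAverage k V (fun _ => a) = a := by
  have := Fintype.ofFinite (N ⧸ V)
  rw [cosetAverage, finsum_eq_sum_of_fintype, Finset.sum_const, Finset.card_univ,
    ← Nat.card_eq_fintype_card, ← Subgroup.index, nsmul_eq_mul, ← mul_assoc, mul_comm _⁻¹,
    ZMod.coe_mul_inv_eq_one _ hV.symm, one_mul]

theorem cosetAverage_comp_mul_left {V : Subgroup N} {f : N → ZMod k}
    (hf : ∀ u ∈ V, ∀ y, f (y * u) = f y) (x : N) :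
    cosetAverage k V (fun y => f (x * y)) = cosetAverage k V f := by
  rw [cosetAverage, cosetAverage,
    ← finsum_comp_equiv (MulAction.toPerm x) (f := fun q : N ⧸ V => f q.out)]
  congr 2
  funext q
  obtain ⟨u, hu⟩ := QuotientGroup.mk_out_eq_mul V (x * q.out)
  have hq : MulAction.toPerm x q = ((x * q.out : N) : N ⧸ V) := by
    conv_lhs => rw [← q.out_eq']
    rfl
  rw [hq, hu, hf u u.2]

end CosetAverage

section CoprimeIndexBasis

variable (k : ℕ) (N : Type*) [Group N] [TopologicalSpace N]

/-- The open normal subgroups of index coprime to `k` form a basis of neighbourhoods of the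
identity. For a profinite group this says that it is prime to `k`. -/
def HasCoprimeIndexBasis : Prop :=
  (𝓝 (1 : N)).HasBasis
    (fun V : Subgroup N => V.Normal ∧ IsOpen (V : Set N) ∧ k.Coprime V.index) fun V => V

variable {k N}

theorem HasCoprimeIndexBasis.exists_ultrafilter (hN : HasCoprimeIndexBasis k N) :
    ∃ 𝓤 : Ultrafilter (Subgroup N),
      (∀ᶠ V : Subgroup N in 𝓤, IsOpen (V : Set N) ∧ k.Coprime V.index) ∧
      ∀ U ∈ 𝓝 (1 : N), ∀ᶠ V : Subgroup N in 𝓤, (V : Set N) ⊆ U := by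
  let F : Filter (Subgroup N) :=
    comap (↑) (𝓝 (1 : N)).smallSets ⊓ 𝓟 {V | IsOpen (V : Set N) ∧ k.Coprime V.index}
  have hF : F.NeBot := by
    refine inf_principal_neBot_iff.2 fun t ht => ?_
    obtain ⟨S, hS, hSt⟩ := mem_comap.1 ht
    obtain ⟨U, hU, hUS⟩ := eventually_smallSets.1 hS
    obtain ⟨V, ⟨-, hV⟩, hVU⟩ := hN.mem_iff.1 hU
    exact ⟨V, hSt (hUS V hVU), hV⟩
  refine ⟨Ultrafilter.of F, Ultrafilter.of_le _ (mem_inf_of_right (mem_principal_self _)),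
    fun U hU => ?_⟩
  have hU' : ∀ᶠ t in (𝓝 (1 : N)).smallSets, t ⊆ U := eventually_smallSets.2 ⟨U, hU, fun _ => id⟩
  exact (hU'.comap _).filter_mono ((Ultrafilter.of_le _).trans inf_le_left)

theorem eventually_forall_apply_eq {X Y Z : Type*} [TopologicalSpace X] [TopologicalSpace Y]
    [CompactSpace Y] [TopologicalSpace Z] [DiscreteTopology Z] (c : C(X × Y, Z)) (x : X) :
    ∀ᶠ x' in 𝓝 x, ∀ y, c (x', y) = c (x, y) := by
  let d : C(X × Y, Z × Z) := ⟨fun p => (c p, c (x, p.2)), by fun_prop⟩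
  have hopen : IsOpen {p | c p = c (x, p.2)} :=
    (isOpen_discrete {q : Z × Z | q.1 = q.2}).preimage d.continuous
  simpa using isCompact_univ.eventually_forall_of_forall_eventually (x₀ := x)
    (P := fun x' y => c (x', y) = c (x, y)) fun y _ => hopen.mem_nhds (by simp)

variable [IsTopologicalGroup N] [CompactSpace N]

/-- The mean is the limit of the averages over `N ⧸ V` along an ultrafilter of open subgroups `V`
shrinking to the identity. -/
theorem HasCoprimeIndexBasis.exists_mean [NeZero k] (hN : HasCoprimeIndexBasis k N) :
    ∃ m : (N → ZMod k) →+ ZMod k, (∀ a, m (fun _ => a) = a) ∧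
      ∀ f : C(N, ZMod k), ∀ x, m (fun y => f (x * y)) = m f := by
  obtain ⟨𝓤, hV, hsmall⟩ := hN.exists_ultrafilter
  have hlim (f : N → ZMod k) : ∃ a, ∀ᶠ V in 𝓤, cosetAverage k V f = a := by
    obtain ⟨a, ha⟩ := Ultrafilter.eq_pure_of_finite (𝓤.map fun V => cosetAverage k V f)
    exact ⟨a, Ultrafilter.mem_map.1 (ha ▸ Ultrafilter.mem_pure.2 (Set.mem_singleton a))⟩
  choose m hm using hlim
  refine ⟨AddMonoidHom.mk' m fun f g => ?_, fun a => ?_, fun f x => ?_⟩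
  · obtain ⟨V, ⟨hopen, -⟩, hfg, hf, hg⟩ :=
      (hV.and ((hm (f + g)).and ((hm f).and (hm g)))).exists
    have := V.quotient_finite_of_isOpen hopen
    rw [← hfg, ← hf, ← hg, cosetAverage_add]
  · obtain ⟨V, ⟨hopen, hcoprime⟩, ha⟩ := (hV.and (hm fun _ => a)).exists
    have := V.quotient_finite_of_isOpen hopen
    exact ha.symm.trans (cosetAverage_const hcoprime a)
  · let c : C(N × N, ZMod k) := ⟨fun p => f (p.2 * p.1), by fun_prop⟩
    obtain ⟨V, hVf, hfx, hf⟩ := ((hsmall _ (eventually_forall_apply_eq c 1)).and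
      ((hm fun y => f (x * y)).and (hm f))).exists
    refine hfx.symm.trans (.trans (cosetAverage_comp_mul_left (fun u hu y => ?_) x) hf)
    simpa [c] using hVf hu y

end CoprimeIndexBasis

section NoSmallSubgroups

/-- Some neighbourhood of zero contains no nontrivial subgroup. -/
def NoSmallSubgroups (A : Type*) [AddGroup A] [TopologicalSpace A] : Prop :=
  ∃ W ∈ 𝓝 (0 : A), ∀ H : AddSubgroup A, (H : Set A) ⊆ W → H = ⊥

theorem noSmallSubgroups_of_discreteTopology (A : Type*) [AddGroup A] [TopologicalSpace A]
    [DiscreteTopology A] : NoSmallSubgroups A :=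
  ⟨{0}, by simp, fun _ hH => eq_bot_iff.2 hH⟩

/-- If `x` is close to `1`, then squaring it moves it away from `1` by a factor of at least `3/2`,
since `x ^ 2 - 1 = (x + 1) * (x - 1)`. -/
theorem three_halves_pow_mul_norm_sub_one_le {x : ℂ} (hx : ∀ m : ℕ, ‖x ^ m - 1‖ ≤ 1 / 2)
    (j : ℕ) : (3 / 2) ^ j * ‖x - 1‖ ≤ ‖x ^ 2 ^ j - 1‖ := by
  induction j with
  | zero => simp
  | succ j ih =>
    set y := x ^ 2 ^ j
    have hy : 3 / 2 ≤ ‖y + 1‖ := by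
      have := norm_sub_le (y + 1) (y - 1)
      rw [show y + 1 - (y - 1) = 2 by ring, Complex.norm_ofNat] at this
      linarith [hx (2 ^ j)]
    calc (3 / 2) ^ (j + 1) * ‖x - 1‖ = 3 / 2 * ((3 / 2) ^ j * ‖x - 1‖) := by ring
      _ ≤ ‖y + 1‖ * ‖y - 1‖ := by gcongr
      _ = ‖x ^ 2 ^ (j + 1) - 1‖ := by rw [← norm_mul, pow_succ, pow_mul]; congr 1; ring

theorem eq_one_of_forall_norm_pow_sub_one_le {x : ℂ} (hx : ∀ m : ℕ, ‖x ^ m - 1‖ ≤ 1 / 2) :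
    x = 1 := by
  by_contra hne
  have hpos : 0 < ‖x - 1‖ := norm_pos_iff.2 (sub_ne_zero.2 hne)
  obtain ⟨j, hj⟩ := pow_unbounded_of_one_lt (1 / ‖x - 1‖) (by norm_num : (1 : ℝ) < 3 / 2)
  rw [div_lt_iff₀ hpos] at hj
  linarith [three_halves_pow_mul_norm_sub_one_le hx j, hx (2 ^ j)]

theorem noSmallSubgroups_complexUnits : NoSmallSubgroups (Additive ℂˣ) := by
  have hcont : Continuous fun x : Additive ℂˣ => ‖(x.toMul : ℂ) - 1‖ :=
    ((Units.continuous_val.comp continuous_toMul).sub continuous_const).norm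
  refine ⟨{x | ‖(x.toMul : ℂ) - 1‖ < 1 / 2},
    (isOpen_lt hcont continuous_const).mem_nhds (by simp), fun H hH => eq_bot_iff.2 fun x hx => ?_⟩
  have hpow (m : ℕ) : ‖(x.toMul : ℂ) ^ m - 1‖ ≤ 1 / 2 := by
    have hm := hH (H.nsmul_mem hx m)
    rw [Set.mem_ofPred_eq, toMul_nsmul, Units.val_pow_eq_pow_val] at hm
    exact hm.le
  exact Units.ext (eq_one_of_forall_norm_pow_sub_one_le hpow)

theorem HasCoprimeIndexBasis.exists_coprime_smul_eq_zero {k : ℕ} {N A : Type*} [Group N]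
    [TopologicalSpace N] (hN : HasCoprimeIndexBasis k N) [AddCommGroup A] [TopologicalSpace A]
    (hA : NoSmallSubgroups A) (χ : Additive N →+ A)
    (hχ : Continuous fun x : N => χ (.ofMul x)) :
    ∃ M : ℕ, k.Coprime M ∧ ∀ x, M • χ x = 0 := by
  obtain ⟨W, hW, hWA⟩ := hA
  have hχW : ∀ᶠ x : N in 𝓝 1, χ (.ofMul x) ∈ W := hχ.continuousAt (by simpa using hW)
  obtain ⟨V, ⟨hV, -, hcoprime⟩, hVW⟩ := hN.mem_iff.1 hχW
  have hmap : V.toAddSubgroup.map χ = ⊥ := hWA _ <| by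
    rintro _ ⟨v, hv, rfl⟩
    exact hVW hv
  refine ⟨V.index, hcoprime, fun x => ?_⟩
  rw [← map_nsmul, ← AddSubgroup.mem_bot, ← hmap]
  exact ⟨_, V.pow_index_mem x.toMul, rfl⟩

end NoSmallSubgroups

section RightInvariant

variable {k : ℕ} [NeZero k] {G : Type*} [Group G] [TopologicalSpace G] [IsTopologicalGroup G]
  {N : Subgroup G} [CompactSpace N]

/-- Averaging the cocycle identity over `N` in its last variable exhibits the mean of `c g` over
the coset `h * N`, up to a term depending only on `g`, as a representative of the same class. -/
theorem HasCoprimeIndexBasis.exists_sub_coboundary_right_invariant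
    (hN : HasCoprimeIndexBasis k N) (c : contTwoCocycles G (ZMod k)) :
    ∃ b : C(G, ZMod k), ∀ g h, ∀ x ∈ N,
      c.1 (g, h * x) - coboundary b g (h * x) = c.1 (g, h) - coboundary b g h := by
  obtain ⟨m, m_const, m_inv⟩ := hN.exists_mean
  let cN : C(G × N, ZMod k) := ⟨fun p => c.1 (p.1, p.2), by fun_prop⟩
  let b : C(G, ZMod k) := ⟨fun g => m fun x => c.1 (g, x),
    ((IsLocallyConstant.iff_eventually_eq _).2 fun g => (eventually_forall_apply_eq cN g).mono
      fun _ hg => congrArg m (funext hg)).continuous⟩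
  have hmean (g h : G) :
      c.1 (g, h) - coboundary b g h = m (fun x => c.1 (g, h * x)) - b g := by
    have hsum : b h + m (fun x => c.1 (g, h * x)) = b (g * h) + c.1 (g, h) := by
      rw [← m_const (c.1 (g, h))]
      change m _ + m _ = m _ + m _
      rw [← map_add, ← map_add]
      exact congrArg m (funext fun x => c.2 g h x)
    rw [coboundary_apply]
    linear_combination -hsum
  refine ⟨b, fun g h x hx => ?_⟩
  let f : C(N, ZMod k) := ⟨fun y => c.1 (g, h * y), by fun_prop⟩
  rw [hmean, hmean]
  have hinv : m (fun y => c.1 (g, h * (x * y))) = m (fun y => c.1 (g, h * y)) := m_inv f ⟨x, hx⟩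
  simp only [mul_assoc, hinv]

/-- For fixed `h`, such a cocycle is additive in `x ∈ N` up to the constant `d 1 1`, and an
invariant mean annihilates every homomorphism. -/
theorem HasCoprimeIndexBasis.left_invariant_of_right_invariant (hN : HasCoprimeIndexBasis k N)
    [N.Normal] {d : G → G → ZMod k} (hd : IsTwoCocycle d)
    (hcont : ∀ h, Continuous fun x : N => d x h)
    (hright : ∀ g h, ∀ x ∈ N, d g (h * x) = d g h) (g h : G) (x : N) : d (g * x) h = d g h := by
  have hmul (g : G) (x : N) : d (g * x) h = (d x h - d 1 1) + d g h := by
    have hgx : d g x = d 1 1 := by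
      rw [← hd.one_right g, ← hright g 1 x x.2, one_mul]
    have hconj : d g (x * h) = d g h := by
      rw [← hright g h _ (‹N.Normal›.conj_mem x x.2 h⁻¹)]
      simp [mul_assoc]
    linear_combination hconj - hd g x h - hgx
  obtain ⟨m, m_const, m_inv⟩ := hN.exists_mean
  have hker : d x h - d 1 1 = 0 := by
    have hm : m (fun y : N => d (x * y) h) = m fun y => d y h := m_inv ⟨_, hcont h⟩ x
    have hadd : (fun y : N => d (x * y) h) = (fun y : N => d y h) + fun _ => d x h - d 1 1 :=
      funext fun y => by rw [hmul, Pi.add_apply, sub_add_eq_add_sub, add_sub_assoc]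
    rwa [hadd, map_add, m_const, add_eq_left] at hm
  rw [hmul, hker, zero_add]

end RightInvariant

section Inflation

variable {G Q A : Type*} [Group G] [Group Q] {π : G →* Q} [AddCommGroup A]

theorem exists_descent {B : Type*} (hπ : Function.Surjective π) {f : G → G → B}
    (hleft : ∀ g h, ∀ x : π.ker, f (g * x) h = f g h)
    (hright : ∀ g h, ∀ x ∈ π.ker, f g (h * x) = f g h) :
    ∃ f₀ : Q → Q → B, ∀ g h, f₀ (π g) (π h) = f g h := by
  obtain ⟨s, hs⟩ := hπ.hasRightInverse
  have hs' (g : G) : ∃ x : π.ker, s (π g) = g * x :=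
    ⟨⟨g⁻¹ * s (π g), by simp [MonoidHom.mem_ker, hs (π g)]⟩, by simp⟩
  refine ⟨fun p q => f (s p) (s q), fun g h => ?_⟩
  obtain ⟨x, hx⟩ := hs' g
  obtain ⟨y, hy⟩ := hs' h
  simp only [hx, hy, hleft, hright _ _ _ y.2]

theorem IsTwoCocycle.comp {c : Q → Q → A} (hc : IsTwoCocycle c) (π : G →* Q) :
    IsTwoCocycle fun g h => c (π g) (π h) := fun g h l => by
  simpa only [map_mul] using hc (π g) (π h) (π l)

theorem IsTwoCocycle.of_comp (hπ : Function.Surjective π) {c : Q → Q → A}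
    (hc : IsTwoCocycle fun g h => c (π g) (π h)) : IsTwoCocycle c := fun p q t => by
  obtain ⟨g, rfl⟩ := hπ p
  obtain ⟨h, rfl⟩ := hπ q
  obtain ⟨l, rfl⟩ := hπ t
  simpa only [map_mul] using hc g h l

variable [TopologicalSpace G] [TopologicalSpace A] [IsTopologicalAddGroup A]

/-- If `c` inflates to the coboundary of `b`, then `b` restricts to a homomorphism on the kernel up
to a constant. A multiple of `b` by an integer prime to `k` descends to the quotient, and
multiplication by that integer is invertible on the multiples of `c`. -/
theorem isTwoCoboundary_of_inflation {k : ℕ} (hπ : Function.Surjective π)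
    (hN : HasCoprimeIndexBasis k π.ker) (hA : NoSmallSubgroups A) {c : Q → Q → A}
    (hc : IsTwoCocycle c) (hk : k • c = 0) (b : C(G, A))
    (hb : ∀ g h, c (π g) (π h) = coboundary b g h) : IsTwoCoboundary c := by
  have hb_one : c 1 1 = b 1 := by simpa using hb 1 1
  have hker (g : G) (x : π.ker) : b (g * x) = b g + (b x - b 1) := by
    have hgx := hb g x
    rw [show π (x : G) = 1 from x.2, hc.one_right, hb_one, coboundary_apply] at hgx
    rw [hgx]
    abel
  let χ : Additive π.ker →+ A := AddMonoidHom.mk' (fun x => b x.toMul - b 1) fun x y => by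
    rw [toMul_add, Subgroup.coe_mul, hker]
    abel
  obtain ⟨M, hM, hMχ⟩ := hN.exists_coprime_smul_eq_zero hA χ
    (show Continuous fun x : π.ker => b x - b 1 by fun_prop)
  obtain ⟨s, hs⟩ := hπ.hasRightInverse
  have hdescend (g : G) : M • b (s (π g)) = M • b g := by
    let x : π.ker := ⟨g⁻¹ * s (π g), by simp [MonoidHom.mem_ker, hs (π g)]⟩
    have hx : M • (b x - b 1) = 0 := hMχ (.ofMul x)
    rw [show s (π g) = g * x by simp [x], hker, nsmul_add, hx, add_zero]
  have hMc : M • c = coboundary fun p => M • b (s p) := by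
    funext p q
    obtain ⟨g, rfl⟩ := hπ p
    obtain ⟨h, rfl⟩ := hπ q
    simp only [Pi.smul_apply, coboundary_apply, ← map_mul, hdescend]
    rw [hb, coboundary_apply, nsmul_sub, nsmul_add]
  have hbezout : c = Nat.gcdB k M • M • c := by
    have hgcd := Nat.gcd_eq_gcd_ab k M
    rw [hM, Nat.cast_one] at hgcd
    calc c = (1 : ℤ) • c := (one_zsmul c).symm
      _ = Nat.gcdA k M • k • c + Nat.gcdB k M • M • c := by
        rw [hgcd, add_zsmul, mul_comm (k : ℤ), mul_comm (M : ℤ), mul_zsmul, mul_zsmul,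
          natCast_zsmul, natCast_zsmul]
      _ = Nat.gcdB k M • M • c := by rw [hk, zsmul_zero, zero_add]
  exact ⟨_, by rw [hbezout, hMc, ← map_zsmul]⟩

variable [IsTopologicalGroup G]

theorem continuous_comp_of_isOpen_ker (hopen : IsOpen (π.ker : Set G)) {X : Type*}
    [TopologicalSpace X] (f : Q → X) : Continuous fun g => f (π g) := by
  refine ((IsLocallyConstant.iff_eventually_eq _).2 fun g => ?_).continuous
  have hker : ∀ᶠ h in 𝓝 g, g⁻¹ * h ∈ π.ker :=
    (continuous_const_mul g⁻¹).continuousAt (hopen.mem_nhds (by simp))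
  filter_upwards [hker] with h hh
  rw [MonoidHom.mem_ker, map_mul, map_inv, inv_mul_eq_one] at hh
  rw [hh]

theorem continuous_comp₂_of_isOpen_ker (hopen : IsOpen (π.ker : Set G)) {X : Type*}
    [TopologicalSpace X] (f : Q → Q → X) : Continuous fun p : G × G => f (π p.1) (π p.2) := by
  refine continuous_comp_of_isOpen_ker (π := π.prodMap π) ?_ fun p : Q × Q => f p.1 p.2
  rw [MonoidHom.ker_prodMap]
  exact hopen.prod hopen

/-- The pullback of cocycles along a homomorphism with open kernel. -/
def inflation (hopen : IsOpen (π.ker : Set G)) (A : Type*) [AddCommGroup A] [TopologicalSpace A]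
    [IsTopologicalAddGroup A] : twoCocycles Q A →+ contTwoCocycles G A where
  toFun c := ⟨⟨fun p => c.1 (π p.1) (π p.2), continuous_comp₂_of_isOpen_ker hopen c.1⟩,
    IsTwoCocycle.comp c.2 π⟩
  map_zero' := rfl
  map_add' _ _ := rfl

end Inflation

namespace contH2

variable {G : Type v} {Q : Type*} [Group G] [TopologicalSpace G] [IsTopologicalGroup G] [Group Q]
  {π : G →* Q} {k : ℕ} (hπ : Function.Surjective π) (hopen : IsOpen (π.ker : Set G))
  (hN : HasCoprimeIndexBasis k π.ker)

include hπ hN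

theorem mk_inflation_eq_zero_iff {A : Type} [AddCommGroup A] [TopologicalSpace A]
    [IsTopologicalAddGroup A] (hA : NoSmallSubgroups A) {c : twoCocycles Q A} (hk : k • c = 0) :
    mk (inflation hopen A c) = 0 ↔ IsTwoCoboundary c.1 := by
  rw [mk_eq_zero_iff]
  refine ⟨fun ⟨b, hb⟩ => isTwoCoboundary_of_inflation hπ hN hA c.2 (congrArg Subtype.val hk) b hb,
    fun ⟨b, hb⟩ => ⟨⟨fun g => b (π g), continuous_comp_of_isOpen_ker hopen b⟩, fun g h => ?_⟩⟩
  change c.1 (π g) (π h) = b (π g) + b (π h) - b (π (g * h))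
  rw [hb, coboundary_apply, map_mul]

theorem mk_comp_inflation_surjective [LocallyCompactSpace G] [NeZero k] [CompactSpace π.ker] :
    Function.Surjective (mk.comp (inflation hopen (ZMod k))) := fun x => by
  obtain ⟨c, rfl⟩ := mk_surjective x
  obtain ⟨b, hright⟩ := hN.exists_sub_coboundary_right_invariant c
  have hd : IsTwoCocycle fun g h => c.1 (g, h) - coboundary b g h :=
    (twoCocycles G (ZMod k)).sub_mem c.2 (isTwoCocycle_coboundary b)
  obtain ⟨c₀, hc₀⟩ := exists_descent hπ
    (hN.left_invariant_of_right_invariant hd (fun h => by simp only [coboundary_apply]; fun_prop)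
      hright) hright
  refine ⟨⟨c₀, .of_comp hπ (by simpa only [hc₀] using hd)⟩, ?_⟩
  rw [eq_comm, ← sub_eq_zero, AddMonoidHom.comp_apply, ← map_sub, mk_eq_zero_iff]
  refine ⟨b, fun g h => ?_⟩
  change c.1 (g, h) - c₀ (π g) (π h) = _
  rw [hc₀, sub_sub_cancel]

end contH2

section ContinuousRoots

theorem HasCoprimeIndexBasis.nonarchimedeanGroup {k : ℕ} {N : Type*} [Group N] [TopologicalSpace N]
    [IsTopologicalGroup N] (hN : HasCoprimeIndexBasis k N) : NonarchimedeanGroup N where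
  is_nonarchimedean _ hU :=
    let ⟨V, ⟨_, hV, _⟩, hVU⟩ := hN.mem_iff.1 hU
    ⟨⟨V, hV⟩, hVU⟩

/-- The principal `k`-th root on `ℂˣ`, written additively. -/
noncomputable def principalRoot (k : ℕ) (u : Additive ℂˣ) : Additive ℂˣ :=
  .ofMul (Units.mk0 ((u.toMul : ℂ) ^ (k : ℂ)⁻¹) (by simp [Complex.cpow_eq_zero_iff]))

theorem nsmul_principalRoot (k : ℕ) [NeZero k] (u : Additive ℂˣ) : k • principalRoot k u = u :=
  Additive.toMul.injective (Units.ext (Complex.cpow_nat_inv_pow _ (NeZero.ne k)))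

theorem continuousAt_principalRoot {k : ℕ} {u : Additive ℂˣ}
    (hu : (u.toMul : ℂ) ∈ Complex.slitPlane) : ContinuousAt (principalRoot k) u :=
  Units.isEmbedding_val₀.continuousAt_iff.2 <| (continuousAt_cpow_const hu).comp
    (f := fun u : Additive ℂˣ => (u.toMul : ℂ))
    (Units.continuous_val.comp continuous_toMul).continuousAt

variable {k : ℕ}

theorem exists_continuous_nsmul_eq_of_profinite [NeZero k] {X : Type*} [TopologicalSpace X]
    [CompactSpace X] [T2Space X] [TotallyDisconnectedSpace X] (f : C(X, Additive ℂˣ)) :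
    ∃ γ : C(X, Additive ℂˣ), ∀ x, k • γ x = f x := by
  let S : Set (Additive ℂˣ × Additive ℂˣ) := {p | ((p.1 - p.2).toMul : ℂ) ∈ Complex.slitPlane}
  have hSopen : IsOpen S := Complex.isOpen_slitPlane.preimage
    (Units.continuous_val.comp (continuous_toMul.comp continuous_sub))
  have hS : S ∈ nhdsSet (Set.diagonal (Additive ℂˣ)) := by
    refine hSopen.mem_nhdsSet.2 ?_
    rintro ⟨u, w⟩ (rfl : u = w)
    simp [S, Set.mem_ofPred_eq]
  obtain ⟨m, g, h, hg, hgh⟩ := f.exists_finite_approximation_of_mem_nhds_diagonal hS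
  have hlc {Y : Type} [TopologicalSpace Y] (φ : Fin m → Y) : Continuous fun x => φ (g x) :=
    continuous_of_discreteTopology.comp hg
  refine ⟨⟨fun x => principalRoot k (h (g x)) + principalRoot k (f x - h (g x)),
    (hlc fun i => principalRoot k (h i)).add (continuous_iff_continuousAt.2 fun x => ?_)⟩,
    fun x => ?_⟩
  · exact (continuousAt_principalRoot (hgh x)).comp (f := fun x => f x - h (g x))
      (f.continuous.sub (hlc h)).continuousAt
  · rw [ContinuousMap.coe_mk, nsmul_add, nsmul_principalRoot, nsmul_principalRoot, add_sub_cancel]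

theorem exists_continuous_nsmul_eq_of_isOpen {G A : Type*} [Group G] [TopologicalSpace G]
    [IsTopologicalGroup G] [AddMonoid A] [TopologicalSpace A] {N : Subgroup G}
    (hopen : IsOpen (N : Set G)) (hN : ∀ f : C(N, A), ∃ γ : C(N, A), ∀ x, k • γ x = f x)
    (f : C(G, A)) : ∃ γ : C(G, A), ∀ g, k • γ g = f g := by
  have := QuotientGroup.discreteTopology hopen
  choose γ hγ using fun q : G ⧸ N =>
    hN ⟨fun x => f (q.out * x), f.continuous.comp (continuous_const.mul continuous_subtype_val)⟩
  have hout (g : G) : (g : G ⧸ N).out⁻¹ * g ∈ N := QuotientGroup.eq.1 (QuotientGroup.out_eq' _)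
  let coords (g : G) : (G ⧸ N) × N := (g, ⟨(g : G ⧸ N).out⁻¹ * g, hout g⟩)
  have hcoords : Continuous coords := by
    have hout_inv : Continuous fun g : G => (g : G ⧸ N).out⁻¹ :=
      (continuous_of_discreteTopology (f := fun q : G ⧸ N => q.out⁻¹)).comp continuous_quotient_mk'
    exact continuous_quotient_mk'.prodMk ((hout_inv.mul continuous_id).subtype_mk _)
  have hγcont : Continuous fun p : (G ⧸ N) × N => γ p.1 p.2 :=
    continuous_prod_of_discrete_left.2 fun q => (γ q).continuous
  refine ⟨⟨fun g => γ (coords g).1 (coords g).2, hγcont.comp hcoords⟩, fun g => ?_⟩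
  exact (hγ _ _).trans (congrArg f (mul_inv_cancel_left _ g))

end ContinuousRoots

section RootsOfUnity

variable {k : ℕ} {A : Type*} [AddCommGroup A] {χ : ZMod k →+ A}

/-- The homomorphism `χ` identifies `ZMod k` with the `k`-torsion of `A`. -/
structure IsTorsionParametrization (χ : ZMod k →+ A) : Prop where
  injective : Function.Injective χ
  exists_apply_eq {a : A} : k • a = 0 → ∃ t, χ t = a

theorem exists_isTorsionParametrization_complexUnits (k : ℕ) [NeZero k] :
    ∃ χ : ZMod k →+ Additive ℂˣ, IsTorsionParametrization χ := by
  have hζ := (Complex.isPrimitiveRoot_exp k (NeZero.ne k)).isUnit_unit (NeZero.ne k)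
  let e := hζ.zmodEquivZPowers
  refine ⟨(Subgroup.subtype _).toAdditive.comp e.toAddMonoidHom,
    Subtype.val_injective.comp e.injective, fun {a} ha => ?_⟩
  have ha' : a.toMul ∈ rootsOfUnity k ℂ := ha
  rw [← hζ.zpowers_eq] at ha'
  exact ⟨e.symm (.ofMul ⟨_, ha'⟩), congrArg (Subgroup.subtype _).toAdditive (e.apply_symm_apply _)⟩

theorem nsmul_map_zmod (χ : ZMod k →+ A) (t : ZMod k) : k • χ t = 0 := by
  rw [← map_nsmul, nsmul_eq_mul, CharP.cast_eq_zero, zero_mul, map_zero]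

theorem exists_bezout_zmod {m n : ℕ} (h : m.Coprime n) (k : ℕ) :
    ∃ s t : ZMod k, m * s + n * t = 1 :=
  ⟨(m.gcdA n : ℤ), (m.gcdB n : ℤ), by
    have := Nat.gcd_eq_gcd_ab m n
    rw [h] at this
    exact_mod_cast congrArg (Int.cast : ℤ → ZMod k) this.symm⟩

theorem IsTorsionParametrization.exists_nsmul_eq_iff (hχ : IsTorsionParametrization χ) {d m l : ℕ}
    (hdiv : ∀ a : A, ∃ z, d • z = a) (hml : m.Coprime l) (a b : ZMod k) :
    (∃ z, χ a = (d * m) • z ∧ χ b = z - (1 + d * l) • z) ↔ a * l + b * m = 0 := by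
  have hfst (z : A) : (d * m) • z = m • d • z := by rw [mul_comm, mul_nsmul']
  have hsnd (z : A) : z - (1 + d * l) • z = -(l • d • z) := by
    rw [add_nsmul, one_nsmul, mul_comm, mul_nsmul']
    abel
  have hnsmul (j : ℕ) (t : ZMod k) : j • χ t = χ (j * t) := by rw [← map_nsmul, nsmul_eq_mul]
  simp only [hfst, hsnd]
  refine ⟨fun ⟨z, ha, hb⟩ => ?_, fun hab => ?_⟩
  · have hm : m • k • d • z = 0 := by rw [nsmul_left_comm, ← ha, nsmul_map_zmod]
    have hl : l • k • d • z = 0 := by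
      rw [nsmul_left_comm, ← neg_eq_zero, ← smul_neg, ← hb, nsmul_map_zmod]
    obtain ⟨t, ht⟩ := hχ.exists_apply_eq (a := d • z) <| AddMonoid.addOrderOf_eq_one_iff.1 <|
      Nat.eq_one_of_dvd_coprimes hml (addOrderOf_dvd_of_nsmul_eq_zero hm)
        (addOrderOf_dvd_of_nsmul_eq_zero hl)
    rw [← ht, hnsmul] at ha hb
    rw [← map_neg] at hb
    rw [hχ.injective ha, hχ.injective hb]
    ring
  · obtain ⟨s, t, hst⟩ := exists_bezout_zmod hml k
    obtain ⟨z, hz⟩ := hdiv (χ (a * s - b * t))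
    refine ⟨z, ?_, ?_⟩
    · rw [hz, hnsmul]
      congr 1
      linear_combination -a * hst + t * hab
    · rw [hz, hnsmul, ← map_neg]
      congr 1
      linear_combination -b * hst + s * hab

theorem IsTorsionParametrization.exists_continuous_lift [NeZero k] [TopologicalSpace A] [T2Space A]
    (hχ : IsTorsionParametrization χ) {X : Type*} [TopologicalSpace X] (f : C(X, A))
    (hf : ∀ x, k • f x = 0) : ∃ s : C(X, ZMod k), ∀ x, χ (s x) = f x := by
  choose s hs using fun x => hχ.exists_apply_eq (hf x)
  have hemb := (continuous_of_discreteTopology (f := χ)).isClosedEmbedding hχ.injective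
  exact ⟨⟨s, hemb.isInducing.continuous_iff.2 (f.continuous.congr fun x => (hs x).symm)⟩, hs⟩

end RootsOfUnity

namespace contH2

variable {G : Type v} [Group G] [TopologicalSpace G] [IsTopologicalGroup G]
  {A B : Type} [AddCommGroup A] [TopologicalSpace A] [IsTopologicalAddGroup A]
  [AddCommGroup B] [TopologicalSpace B] [IsTopologicalAddGroup B]

variable (G) in
/-- The map induced on continuous 2-cocycles by a continuous homomorphism of coefficients. -/
def cocyclesMap (f : A →+ B) (hf : Continuous f) : contTwoCocycles G A →+ contTwoCocycles G B where
  toFun c := ⟨⟨fun p => f (c.1 p), hf.comp c.1.continuous⟩, (twoCocyclesMap G f ⟨_, c.2⟩).2⟩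
  map_zero' := Subtype.ext (ContinuousMap.ext fun _ => map_zero f)
  map_add' _ _ := Subtype.ext (ContinuousMap.ext fun _ => map_add f _ _)

theorem mk_cocyclesMap_eq {f : A →+ B} (hf : Continuous f) {c d : contTwoCocycles G A}
    (h : mk c = mk d) : mk (cocyclesMap G f hf c) = mk (cocyclesMap G f hf d) := by
  rw [← sub_eq_zero, ← map_sub, mk_eq_zero_iff] at h ⊢
  obtain ⟨b, hb⟩ := h
  refine ⟨⟨fun g => f (b g), hf.comp b.continuous⟩, fun g k => ?_⟩
  have hfb := congrArg f (hb g k)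
  simp only [coboundary_apply, map_add, map_sub] at hfb
  rw [← map_sub]
  exact hfb

theorem exists_mk_cocyclesMap_eq [LocallyCompactSpace G] [T2Space A] {k : ℕ} [NeZero k]
    {χ : ZMod k →+ A} (hχ : IsTorsionParametrization χ)
    (hroot : ∀ f : C(G, A), ∃ γ : C(G, A), ∀ g, k • γ g = f g) {x : contH2 G A} (hx : k • x = 0) :
    ∃ s : contTwoCocycles G (ZMod k),
      mk (cocyclesMap G χ continuous_of_discreteTopology s) = x := by
  obtain ⟨c, rfl⟩ := mk_surjective x
  rw [← map_nsmul, mk_eq_zero_iff] at hx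
  obtain ⟨β, hβ⟩ := hx
  obtain ⟨γ, hγ⟩ := hroot β
  let d : contTwoCocycles G A := ⟨⟨fun p => c.1 p - coboundary γ p.1 p.2, by
    simp only [coboundary_apply]
    fun_prop⟩, (twoCocycles G A).sub_mem c.2 (isTwoCocycle_coboundary γ)⟩
  have hd : ∀ p, k • d.1 p = 0 := fun p => by
    change k • (c.1 p - (γ p.1 + γ p.2 - γ (p.1 * p.2))) = 0
    have hβp : k • c.1 p = β p.1 + β p.2 - β (p.1 * p.2) := hβ p.1 p.2
    rw [nsmul_sub, hβp, nsmul_sub, nsmul_add, hγ, hγ, hγ, sub_self]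
  obtain ⟨s, hs⟩ := hχ.exists_continuous_lift d.1 hd
  have hs_cocycle : s ∈ contTwoCocycles G (ZMod k) := fun g h l => hχ.injective <| by
    simp only [map_add]
    change χ (s (h, l)) + χ (s (g, h * l)) = χ (s (g * h, l)) + χ (s (g, h))
    simp only [hs]
    exact d.2 g h l
  refine ⟨⟨s, hs_cocycle⟩, ?_⟩
  rw [eq_comm, ← sub_eq_zero, ← map_sub, mk_eq_zero_iff]
  refine ⟨γ, fun g h => ?_⟩
  change c.1 (g, h) - χ (s (g, h)) = _
  rw [hs]
  exact sub_sub_cancel _ _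

end contH2

section Computation

@[to_additive]
theorem nonempty_mulEquiv_of_same_kernel {Z B C : Type*} [Group Z] [Group B] [Group C]
    {f : Z →* B} {g : Z →* C} (hf : Function.Surjective f) (hg : Function.Surjective g)
    (h : ∀ z, f z = 1 ↔ g z = 1) : Nonempty (B ≃* C) :=
  ⟨(QuotientGroup.quotientKerEquivOfSurjective f hf).symm.trans
    ((QuotientGroup.quotientMulEquivOfEq (Subgroup.ext h)).trans
      (QuotientGroup.quotientKerEquivOfSurjective g hg))⟩

theorem locallyCompactSpace_of_isOpen_ker {G Q : Type*} [Group G] [TopologicalSpace G]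
    [IsTopologicalGroup G] [Group Q] {π : G →* Q} (hopen : IsOpen (π.ker : Set G))
    [CompactSpace π.ker] : LocallyCompactSpace G :=
  (isCompact_iff_compactSpace.2 ‹CompactSpace π.ker›).locallyCompactSpace_of_mem_nhds_of_group
    (hopen.mem_nhds (one_mem π.ker))

theorem exists_eq_mul_and_cast_eq {n : ℕ} (hn : n ≠ 0) (r : (ZMod n)ˣ) :
    ∃ d m l : ℕ, d ≠ 0 ∧ m.Coprime l ∧ n = d * m ∧ ((1 + d * l : ℕ) : ZMod n) = r := by
  have : NeZero n := ⟨hn⟩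
  let S := (r : ZMod n).val + n - 1
  obtain ⟨m, l, hml, hm, hl⟩ := Nat.exists_coprime n S
  refine ⟨n.gcd S, m, l, Nat.gcd_ne_zero_left hn, hml, by rwa [mul_comm], ?_⟩
  have hS : 1 + S = (r : ZMod n).val + n := by have := Nat.pos_of_ne_zero hn; omega
  rw [mul_comm, ← hl, hS, Nat.cast_add, ZMod.natCast_self, add_zero, ZMod.natCast_zmod_val]

open CyclicByInt

variable {G : Type v} [Group G] [TopologicalSpace G] [IsTopologicalGroup G]
  {n k : ℕ} {r : (ZMod n)ˣ} {π : G →* CyclicByInt n r} (hπ : Function.Surjective π)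
  (hopen : IsOpen (π.ker : Set G)) (hN : HasCoprimeIndexBasis k π.ker)
  {A : Type} [AddCommGroup A] [TopologicalSpace A] [IsTopologicalAddGroup A]
  (hA : NoSmallSubgroups A) {χ : ZMod k →+ A} (hχ : IsTorsionParametrization χ)
  (hdiv : ∀ d : ℕ, d ≠ 0 → ∀ a : A, ∃ z, d • z = a)

include hπ hN hA hχ hdiv in
theorem mk_inflation_twoCocyclesMap_eq_zero_iff {d m l : ℕ} (hd : d ≠ 0) (hml : m.Coprime l)
    (hdm : n = d * m) (hdl : ((1 + d * l : ℕ) : ZMod n) = r)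
    (c : twoCocycles (CyclicByInt n r) (ZMod k)) :
    contH2.mk (inflation hopen A (twoCocyclesMap _ χ c)) = 0 ↔
      (invariants n r (1 + d * l) (ZMod k) c).1 * l +
        (invariants n r (1 + d * l) (ZMod k) c).2 * m = 0 := by
  rw [contH2.mk_inflation_eq_zero_iff hπ hopen hN hA
    (Subtype.ext (funext₂ fun _ _ => nsmul_map_zmod χ _)),
    isTwoCoboundary_iff (twoCocyclesMap _ χ c).2 hdl, ← hχ.exists_nsmul_eq_iff (hdiv d hd) hml,
    ← hdm]
  change (∃ z, invariants n r _ A (fun g h => χ (c.1 g h)) = _) ↔ _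
  simp only [invariants_comp, Prod.ext_iff]
  rfl

variable [CompactSpace π.ker] (hn : n ≠ 0) (hkn : k ∣ n) (hr : ZMod.unitsMap hkn r = 1)

include hπ hopen hN hn hkn hr

theorem nonempty_contH2_zmod_addEquiv : Nonempty (contH2 G (ZMod k) ≃+ ZMod k × ZMod k) := by
  have : NeZero n := ⟨hn⟩
  have : NeZero k := ⟨ne_zero_of_dvd_ne_zero hn hkn⟩
  have := locallyCompactSpace_of_isOpen_ker hopen
  let R := (r : ZMod n).val
  have hR : (R : ZMod k) = 1 := by
    have hcast : ZMod.castHom hkn (ZMod k) (r : ZMod n) = 1 := congrArg Units.val hr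
    rw [← hcast, ← ZMod.natCast_zmod_val (r : ZMod n), map_natCast]
  refine nonempty_addEquiv_of_same_kernel (contH2.mk_comp_inflation_surjective hπ hopen hN)
    (g := (invariants n r R (ZMod k)).comp (twoCocycles _ _).subtype)
    (exists_cocycle_invariants_eq hn hkn hr R) fun c => ?_
  have hkc : k • c = 0 := Subtype.ext (funext₂ fun _ _ => by simp)
  have hn0 : (n : ZMod k) = 0 := (ZMod.natCast_eq_zero_iff n k).2 hkn
  rw [AddMonoidHom.comp_apply, contH2.mk_inflation_eq_zero_iff hπ hopen hN
    (noSmallSubgroups_of_discreteTopology _) hkc,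
    isTwoCoboundary_iff c.2 (ZMod.natCast_zmod_val (r : ZMod n))]
  simp only [nsmul_eq_mul, hn0, zero_mul, exists_const, R, hR, one_mul, sub_self]
  rfl

include hA hχ hdiv in
theorem nonempty_torsionBy_contH2_addEquiv [T2Space A]
    (hroot : ∀ f : C(G, A), ∃ γ : C(G, A), ∀ g, k • γ g = f g) :
    Nonempty (AddSubgroup.torsionBy (contH2 G A) k ≃+ ZMod k) := by
  have : NeZero k := ⟨ne_zero_of_dvd_ne_zero hn hkn⟩
  have := locallyCompactSpace_of_isOpen_ker hopen
  obtain ⟨d, m, l, hd, hml, hdm, hdl⟩ := exists_eq_mul_and_cast_eq hn r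
  let f : twoCocycles (CyclicByInt n r) (ZMod k) →+ contH2 G A :=
    contH2.mk.comp ((inflation hopen A).comp (twoCocyclesMap _ χ))
  have hf (c) : f c ∈ AddSubgroup.torsionBy (contH2 G A) k :=
    AddSubgroup.torsionBy.nsmul_iff.2 <| by
      rw [← map_nsmul, show k • c = 0 from Subtype.ext (funext₂ fun _ _ => by simp), map_zero]
  let pairing : ZMod k × ZMod k →+ ZMod k :=
    AddMonoidHom.mk' (fun x => x.1 * l + x.2 * m) fun x y => by
      simp only [Prod.fst_add, Prod.snd_add]
      ring
  refine nonempty_addEquiv_of_same_kernel (f := f.codRestrict _ hf)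
    (g := (pairing.comp (invariants n r (1 + d * l) (ZMod k))).comp (twoCocycles _ _).subtype)
    (fun ⟨x, hx⟩ => ?_) (fun t => ?_) fun c => Subtype.ext_iff.trans ?_
  · obtain ⟨s, rfl⟩ := contH2.exists_mk_cocyclesMap_eq hχ hroot
      (AddSubgroup.torsionBy.nsmul_iff.1 hx)
    obtain ⟨c, hc⟩ := contH2.mk_comp_inflation_surjective hπ hopen hN (contH2.mk s)
    exact ⟨c, Subtype.ext (contH2.mk_cocyclesMap_eq continuous_of_discreteTopology hc)⟩
  · obtain ⟨x, y, hxy⟩ := exists_bezout_zmod hml k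
    obtain ⟨c, hc⟩ := exists_cocycle_invariants_eq hn hkn hr (1 + d * l) (t * y, t * x)
    refine ⟨c, (congrArg pairing hc).trans ?_⟩
    change t * y * l + t * x * m = t
    linear_combination t * hxy
  · exact mk_inflation_twoCocyclesMap_eq_zero_iff hπ hopen hN hA hχ hdiv hd hml hdm hdl c

theorem nonempty_torsionBy_contH2_complexUnits_addEquiv [T2Space G] :
    Nonempty (AddSubgroup.torsionBy (contH2 G (Additive ℂˣ)) k ≃+ ZMod k) := by
  have : NeZero k := ⟨ne_zero_of_dvd_ne_zero hn hkn⟩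
  have : T2Space (Additive ℂˣ) := inferInstanceAs (T2Space ℂˣ)
  have := hN.nonarchimedeanGroup
  obtain ⟨χ, hχ⟩ := exists_isTorsionParametrization_complexUnits k
  exact nonempty_torsionBy_contH2_addEquiv hπ hopen hN noSmallSubgroups_complexUnits hχ
    (fun d hd a => have : NeZero d := ⟨hd⟩; ⟨_, nsmul_principalRoot d a⟩) hn hkn hr
    (exists_continuous_nsmul_eq_of_isOpen hopen exists_continuous_nsmul_eq_of_profinite)

end Computation

section CyclicQuotient

open Multiplicative

theorem exists_intAction_eq {n : ℕ} (φ : Multiplicative ℤ →* MulAut (Multiplicative (ZMod n))) :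
    ∃ r : (ZMod n)ˣ, intAction r = φ := by
  obtain ⟨r, hr⟩ :=
    (ZMod.AddAutEquivUnits n).symm.surjective (toAdd (MulAutMultiplicative _ (φ (ofAdd 1))))
  refine ⟨r.toMul, MonoidHom.ext_mint ((MulAutMultiplicative _).injective ?_)⟩
  rw [intAction, MonoidHom.comp_apply, zpowersHom_apply, toAdd_ofAdd, zpow_one]
  exact (MulEquiv.apply_symm_apply _ _).trans hr

theorem exists_mulEquiv_cyclicByInt {G : Type*} [Group G] {v : G →* Multiplicative ℤ}
    (hv : Function.Surjective v) [hc : IsCyclic v.ker] :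
    ∃ r, Nonempty (G ≃* CyclicByInt (Nat.card v.ker) r) := by
  obtain ⟨ϖ, hϖ⟩ := hv (ofAdd 1)
  let S : GroupExtension v.ker G (Multiplicative ℤ) :=
    { inl := v.ker.subtype
      rightHom := v
      inl_injective := v.ker.subtype_injective
      range_inl_eq_ker_rightHom := v.ker.range_subtype
      rightHom_surjective := hv }
  let s : S.Splitting :=
    { zpowersHom G ϖ with
      rightInverse_rightHom := DFunLike.congr_fun (f := v.comp (zpowersHom G ϖ))
        (g := MonoidHom.id _) (MonoidHom.ext_mint (by simpa using hϖ)) }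
  let e := (zmodCyclicMulEquiv hc).symm
  obtain ⟨r, hr⟩ := exists_intAction_eq ((MulAut.congr e).toMonoidHom.comp s.conjAct)
  refine ⟨r, ⟨s.semidirectProductMulEquiv.symm.trans (?_ : _ ≃* _ ⋊[_] _)⟩⟩
  rw [hr]
  exact SemidirectProduct.congr' e (.refl _)

end CyclicQuotient

theorem exists_surjective_int_ker_eq {G C : Type*} [Group G] [Group C] [IsCyclic C] (w : G →* C)
    [Infinite w.range] :
    ∃ v : G →* Multiplicative ℤ, Function.Surjective v ∧ v.ker = w.ker := by
  let e : w.range ≃* Multiplicative ℤ := intCyclicMulEquiv.symm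
  refine ⟨e.toMonoidHom.comp w.rangeRestrict, e.surjective.comp w.rangeRestrict_surjective, ?_⟩
  rw [← MonoidHom.comap_ker, e.toMonoidHom.ker_eq_bot_iff.2 e.injective, MonoidHom.comap_bot,
    MonoidHom.ker_rangeRestrict]

theorem isCyclic_units_of_finite_isDomain (R : Type*) [Ring R] [IsDomain R] [Finite R] :
    IsCyclic Rˣ := by
  have h := Finite.isDomain_to_isField R
  let : CommRing R := { ‹Ring R› with mul_comm := h.mul_comm }
  exact isCyclic_of_injective_ringHom (Units.coeHom R) Units.val_injective

theorem coprime_index_of_mem_of_pow_mem {G : Type*} [Group G] {p : ℕ} (hp : p.Prime)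
    {V : Subgroup G} [V.Normal] [Finite (G ⧸ V)] (hV : ∀ g, g ^ p ∈ V → g ∈ V) :
    p.Coprime V.index := by
  have := Fact.mk hp
  rw [hp.coprime_iff_not_dvd]
  intro hdvd
  obtain ⟨q, hq⟩ := exists_prime_orderOf_dvd_card' (G := G ⧸ V) p hdvd
  obtain ⟨g, rfl⟩ := QuotientGroup.mk_surjective q
  have hg : g ∈ V := hV g <| by
    rw [← QuotientGroup.eq_one_iff, QuotientGroup.mk_pow, ← hq, pow_orderOf_eq_one]
  rw [(QuotientGroup.eq_one_iff g).2 hg, orderOf_one] at hq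
  exact hp.one_lt.ne hq

section ValuedDivisionRing

variable {D : Type*} [DivisionRing D] {Γ : Type*} [LinearOrderedCommGroupWithZero Γ]
  (W : Valuation D Γ)

/-- The homomorphism from the units of a division ring to the value group. -/
def unitsValuation : Dˣ →* Γˣ := Units.map W.toMonoidWithZeroHom.toMonoidHom

variable {W} in
theorem mem_ker_unitsValuation {g : Dˣ} : g ∈ (unitsValuation W).ker ↔ W g = 1 :=
  Units.ext_iff

variable {W} in
theorem valuation_inv_sub_one {g : Dˣ} (hg : W g = 1) :
    W ((g⁻¹ : Dˣ) - 1 : D) = W ((g : D) - 1) := by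
  have h : ((g⁻¹ : Dˣ) - 1 : D) = -((g⁻¹ : Dˣ) * (g - 1 : D)) := by
    rw [mul_sub, Units.inv_mul, mul_one, neg_sub]
  rw [h, Valuation.map_neg, map_mul, Units.val_inv_eq_inv_val, map_inv₀, hg, inv_one, one_mul]

/-- The congruence subgroup of level `γ`: the units of the valuation ring that are within `γ`
of `1`. -/
def congruenceUnits (γ : Γˣ) : Subgroup Dˣ where
  carrier := {g | W g = 1 ∧ W ((g : D) - 1) < γ}
  one_mem' := by simp
  mul_mem' {g h} hg hh := by
    refine ⟨by simp [hg.1, hh.1], ?_⟩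
    have hgh : ((g * h : Dˣ) - 1 : D) = (g - 1) * h + (h - 1) := by
      push_cast
      noncomm_ring
    rw [hgh]
    exact W.map_add_lt (by simpa [hh.1] using hg.2) hh.2
  inv_mem' {g} hg :=
    ⟨by simp [hg.1], (valuation_inv_sub_one hg.1).trans_lt hg.2⟩

variable {W} in
theorem mem_congruenceUnits {γ : Γˣ} {g : Dˣ} :
    g ∈ congruenceUnits W γ ↔ W g = 1 ∧ W ((g : D) - 1) < γ := Iff.rfl

instance (γ : Γˣ) : (congruenceUnits W γ).Normal where
  conj_mem g hg h := by
    have hW : W h * W (h⁻¹ : Dˣ) = 1 := by rw [← map_mul, Units.mul_inv, map_one]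
    have hsub : ((h * g * h⁻¹ : Dˣ) - 1 : D) = h * (g - 1) * (h⁻¹ : Dˣ) := by
      rw [mul_sub, sub_mul, mul_one, Units.mul_inv]
      push_cast
      rfl
    refine ⟨?_, ?_⟩
    · rw [Units.val_mul, Units.val_mul, map_mul, map_mul, hg.1, mul_one, hW]
    · rw [hsub, map_mul, map_mul, mul_right_comm, hW, one_mul]
      exact hg.2

/-- The group of principal units `1 + 𝔪`. -/
abbrev principalUnits : Subgroup Dˣ := congruenceUnits W 1

variable {W} in
theorem mem_principalUnits {g : Dˣ} : g ∈ principalUnits W ↔ W ((g : D) - 1) < 1 := by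
  rw [mem_congruenceUnits, Units.val_one, and_iff_right_iff_imp]
  intro hg
  simpa using W.map_add_eq_of_lt_right (x := (g : D) - 1) (y := 1) (by simpa using hg)

variable {W} in
theorem valuation_geom_sum_eq_one {p : ℕ} (hp : W p = 1) {g : Dˣ} (hg : g ∈ principalUnits W) :
    W (∑ i ∈ Finset.range p, (g : D) ^ i) = 1 := by
  have hlt : W (∑ i ∈ Finset.range p, ((g : D) ^ i - 1)) < W p := by
    rw [hp]
    exact W.map_sum_lt one_ne_zero fun i _ => by
      simpa using mem_principalUnits.1 (pow_mem hg i)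
  have hsum : ∑ i ∈ Finset.range p, (g : D) ^ i =
      ∑ i ∈ Finset.range p, ((g : D) ^ i - 1) + p := by simp
  rw [hsum, W.map_add_eq_of_lt_right hlt, hp]

variable {W} in
theorem mem_congruenceUnits_of_pow_mem {p : ℕ} (hp : W p = 1) {γ : Γˣ} {g : Dˣ}
    (hg : g ∈ principalUnits W) (hgp : g ^ p ∈ congruenceUnits W γ) : g ∈ congruenceUnits W γ := by
  refine ⟨hg.1, ?_⟩
  have h := hgp.2
  rwa [Units.val_pow_eq_pow_val, ← geom_sum_mul, map_mul, valuation_geom_sum_eq_one hp hg,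
    one_mul] at h

section Residue

/-- The maximal ideal of the valuation ring of a division ring. -/
def maxIdeal : Ideal W.integer where
  carrier := {x | W x < 1}
  zero_mem' := by simp
  add_mem' hx hy := W.map_add_lt hx hy
  smul_mem' x y hy := (map_mul W (x : D) y).trans_lt
    (mul_lt_one_of_nonneg_of_lt_one_right x.2 zero_le hy)

variable {W} in
theorem mem_maxIdeal {x : W.integer} : x ∈ maxIdeal W ↔ W x < 1 := Iff.rfl

instance : (maxIdeal W).IsTwoSided where
  mul_mem_of_left {x} y hx := (map_mul W (x : D) y).trans_lt (mul_lt_one_of_lt_of_le hx y.2)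

/-- The residue ring of the valuation ring of a division ring. -/
abbrev ResidueRing : Type _ := W.integer ⧸ maxIdeal W

instance : Nontrivial (ResidueRing W) :=
  Ideal.Quotient.nontrivial_iff.2 fun h => by
    have h1 := mem_maxIdeal.1 ((Ideal.eq_top_iff_one _).1 h)
    simp at h1

instance : IsDomain (ResidueRing W) := by
  have : NoZeroDivisors (ResidueRing W) := ⟨fun {a b} h => by
    obtain ⟨a, rfl⟩ := Ideal.Quotient.mk_surjective a
    obtain ⟨b, rfl⟩ := Ideal.Quotient.mk_surjective b
    rw [← map_mul, Ideal.Quotient.eq_zero_iff_mem, mem_maxIdeal, Subring.coe_mul, map_mul] at h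
    rw [Ideal.Quotient.eq_zero_iff_mem, Ideal.Quotient.eq_zero_iff_mem, mem_maxIdeal, mem_maxIdeal]
    by_contra! hab
    exact h.not_ge (one_le_mul hab.1 hab.2)⟩
  exact NoZeroDivisors.to_isDomain _

/-- Reduction of the units of the valuation ring modulo the maximal ideal. -/
def unitsReduction : (unitsValuation W).ker →* (ResidueRing W)ˣ :=
  (Units.map (Ideal.Quotient.mk (maxIdeal W)).toMonoidHom).comp
    { toFun k :=
        ⟨⟨k.1, (mem_ker_unitsValuation.1 k.2).le⟩,
          ⟨↑k.1⁻¹, (mem_ker_unitsValuation.1 (inv_mem k.2)).le⟩,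
          Subtype.ext k.1.mul_inv, Subtype.ext k.1.inv_mul⟩
      map_one' := rfl
      map_mul' _ _ := rfl }

theorem unitsReduction_surjective : Function.Surjective (unitsReduction W) := fun u => by
  obtain ⟨x, hx⟩ := Ideal.Quotient.mk_surjective (u : ResidueRing W)
  have hx1 : W x = 1 := by
    refine x.2.antisymm (not_lt.1 fun h => u.ne_zero ?_)
    rwa [← hx, Ideal.Quotient.eq_zero_iff_mem]
  have hx0 : (x : D) ≠ 0 := W.ne_zero_iff.1 (hx1.trans_ne one_ne_zero)
  exact ⟨⟨Units.mk0 x hx0, mem_ker_unitsValuation.2 hx1⟩, Units.ext hx⟩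

variable {W} in
theorem unitsReduction_eq_one_iff {k : (unitsValuation W).ker} :
    unitsReduction W k = 1 ↔ (k : Dˣ) ∈ principalUnits W := by
  rw [mem_principalUnits, Units.ext_iff]
  change Ideal.Quotient.mk (maxIdeal W) ⟨k.1, _⟩ = Ideal.Quotient.mk (maxIdeal W) 1 ↔ _
  rw [Ideal.Quotient.mk_eq_mk_iff_sub_mem, mem_maxIdeal]
  rfl

theorem exists_mulEquiv_quotient_principalUnits [IsCyclic Γˣ] [W.IsNontrivial]
    [Finite (ResidueRing W)] :
    ∃ r, Nonempty (Dˣ ⧸ principalUnits W ≃* CyclicByInt (Nat.card (ResidueRing W)ˣ) r) := by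
  have : Nontrivial (unitsValuation W).range := by
    obtain ⟨x, hx0, hx1⟩ := Valuation.IsNontrivial.exists_val_nontrivial (v := W)
    exact ⟨⟨_, Units.mk0 x (W.ne_zero_iff.1 hx0), rfl⟩, 1,
      fun h => hx1 (congrArg Units.val (Subtype.ext_iff.1 h))⟩
  have : Infinite (unitsValuation W).range := inferInstance
  obtain ⟨v, hv, hker⟩ := exists_surjective_int_ker_eq (unitsValuation W)
  have hvker {g : Dˣ} (hg : W g = 1) : v g = 1 := hker.ge (mem_ker_unitsValuation.2 hg)
  let v' : Dˣ ⧸ principalUnits W →* Multiplicative ℤ :=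
    QuotientGroup.lift _ v fun g hg => hvker hg.1
  let ψ : (unitsValuation W).ker →* v'.ker :=
    ((QuotientGroup.mk' _).comp (Subgroup.subtype _)).codRestrict _
      fun k => hvker (mem_ker_unitsValuation.1 k.2)
  have hψ : Function.Surjective ψ := by
    rintro ⟨q, hq⟩
    obtain ⟨g, rfl⟩ := QuotientGroup.mk_surjective q
    exact ⟨⟨g, hker.le hq⟩, rfl⟩
  obtain ⟨e⟩ := nonempty_mulEquiv_of_same_kernel hψ (unitsReduction_surjective W) fun k => by
    rw [unitsReduction_eq_one_iff, ← QuotientGroup.eq_one_iff, Subtype.ext_iff]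
    rfl
  have := isCyclic_units_of_finite_isDomain (ResidueRing W)
  have : IsCyclic v'.ker := isCyclic_of_injective e.toMonoidHom e.injective
  rw [← Nat.card_congr e.toEquiv]
  exact exists_mulEquiv_cyclicByInt (QuotientGroup.lift_surjective_of_surjective _ v hv _)

theorem exists_surjective_cyclicByInt_ker_eq [IsCyclic Γˣ] [W.IsNontrivial]
    [Finite (ResidueRing W)] :
    ∃ r, ∃ π : Dˣ →* CyclicByInt (Nat.card (ResidueRing W)ˣ) r,
      Function.Surjective π ∧ π.ker = principalUnits W := by
  obtain ⟨r, ⟨e⟩⟩ := exists_mulEquiv_quotient_principalUnits W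
  refine ⟨r, e.toMonoidHom.comp (QuotientGroup.mk' _),
    e.surjective.comp (QuotientGroup.mk'_surjective _), ?_⟩
  rw [← MonoidHom.comap_ker, e.toMonoidHom.ker_eq_bot_iff.2 e.injective, MonoidHom.comap_bot,
    QuotientGroup.ker_mk']

theorem two_dvd_card_units_residueRing (h2 : W 2 = 1) : 2 ∣ Nat.card (ResidueRing W)ˣ := by
  have hne : (-1 : (ResidueRing W)ˣ) ≠ 1 := fun h => by
    have h1 : (-1 : ResidueRing W) = 1 := congrArg Units.val h
    have h3 : Ideal.Quotient.mk (maxIdeal W) 2 = 0 := by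
      rw [← one_add_one_eq_two, map_add, map_one]
      nth_rewrite 1 [← h1]
      exact neg_add_cancel _
    exact (mem_maxIdeal.1 (Ideal.Quotient.eq_zero_iff_mem.1 h3)).ne h2
  exact orderOf_eq_prime neg_one_sq hne ▸ orderOf_dvd_natCard _

end Residue

section Topology

variable {W} [TopologicalSpace D] [IsTopologicalRing D]
  (hW : (𝓝 (0 : D)).HasBasis (fun _ : Γˣ => True) fun γ => {x | W x < γ})

include hW

theorem finite_residueRing (hcomp : IsCompact {x | W x ≤ 1}) : Finite (ResidueRing W) := by
  have : CompactSpace W.integer := isCompact_iff_compactSpace.1 hcomp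
  have hopen : IsOpen (W.ltAddSubgroup 1 : Set D) :=
    AddSubgroup.isOpen_of_mem_nhds _ (hW.mem_of_mem (i := 1) trivial)
  exact AddSubgroup.quotient_finite_of_isOpen (maxIdeal W).toAddSubgroup
    (hopen.preimage continuous_subtype_val)

theorem hasBasis_nhds_one_congruenceUnits :
    (𝓝 (1 : Dˣ)).HasBasis (fun _ : Γˣ => True) fun γ => congruenceUnits W γ := by
  have hlt (γ : Γˣ) : ∀ᶠ g : Dˣ in 𝓝 1, W ((g : D) - 1) < γ := by
    have hsub : Tendsto (fun g : Dˣ => (g : D) - 1) (𝓝 1) (𝓝 0) :=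
      (Units.continuous_val.sub continuous_const).tendsto' _ _ (by simp)
    exact hsub.eventually (hW.mem_of_mem (i := γ) trivial)
  refine hasBasis_iff.2 fun U => ⟨fun hU => ?_, fun ⟨γ, _, hγ⟩ => ?_⟩
  · rw [Units.isInducing_embedProduct.nhds_eq_comap] at hU
    obtain ⟨T, hT, hTU⟩ := hU
    let f (x : D × D) : D × Dᵐᵒᵖ := (x.1 + 1, .op (x.2 + 1))
    have hf : Tendsto f (𝓝 0 ×ˢ 𝓝 0) (𝓝 (Units.embedProduct D 1)) := by
      rw [← nhds_prod_eq]
      exact Continuous.tendsto' (by fun_prop) _ _ (by simp [f])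
    obtain ⟨γ, -, hγ⟩ := hW.prod_self.mem_iff.1 (hf hT)
    refine ⟨γ, trivial, fun g hg => hTU ?_⟩
    have hgT : f ((g : D) - 1, (g⁻¹ : Dˣ) - 1) ∈ T :=
      hγ ⟨hg.2, (valuation_inv_sub_one hg.1).trans_lt hg.2⟩
    simpa [f] using hgT
  · filter_upwards [hlt γ, hlt 1] with g hg hg1
    exact hγ ⟨(mem_principalUnits.2 hg1).1, hg⟩

theorem isOpen_congruenceUnits (γ : Γˣ) : IsOpen (congruenceUnits W γ : Set Dˣ) :=
  Subgroup.isOpen_of_mem_nhds _ ((hasBasis_nhds_one_congruenceUnits hW).mem_of_mem trivial)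

theorem isCompact_principalUnits [T2Space D] (hcomp : IsCompact {x | W x ≤ 1}) :
    IsCompact (principalUnits W : Set Dˣ) := by
  have hprod : IsCompact ({x : D | W x ≤ 1} ×ˢ (MulOpposite.op '' {x : D | W x ≤ 1})) :=
    hcomp.prod (hcomp.image MulOpposite.continuous_op)
  refine (Units.isClosedEmbedding_embedProduct.isCompact_preimage hprod).of_isClosed_subset
    (Subgroup.isClosed_of_isOpen _ (isOpen_congruenceUnits hW 1)) fun g hg => ?_
  exact ⟨hg.1.le, _, (inv_mem hg).1.le, rfl⟩

theorem hasCoprimeIndexBasis_principalUnits [CompactSpace (principalUnits W)] {p : ℕ}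
    (hp : p.Prime) (hWp : W p = 1) : HasCoprimeIndexBasis p (principalUnits W) := by
  refine hasBasis_iff.2 fun U => ⟨fun hU => ?_, fun ⟨V, ⟨_, hVo, _⟩, hVU⟩ =>
    mem_of_superset (hVo.mem_nhds (one_mem V)) hVU⟩
  rw [nhds_subtype] at hU
  obtain ⟨γ, -, hγ⟩ := ((hasBasis_nhds_one_congruenceUnits hW).comap _).mem_iff.1 hU
  let V := (congruenceUnits W γ).subgroupOf (principalUnits W)
  have hVo : IsOpen (V : Set (principalUnits W)) :=
    (isOpen_congruenceUnits hW γ).preimage continuous_subtype_val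
  have : Finite (principalUnits W ⧸ V) := V.quotient_finite_of_isOpen hVo
  exact ⟨V, ⟨inferInstance, hVo, coprime_index_of_mem_of_pow_mem hp fun g hg =>
    mem_congruenceUnits_of_pow_mem hWp g.2 hg⟩, hγ⟩

theorem nonempty_contH2_units_addEquiv_of_valuation [T2Space D] [IsCyclic Γˣ] [W.IsNontrivial]
    (hcomp : IsCompact {x | W x ≤ 1}) (h2 : W 2 = 1) :
    Nonempty (contH2 Dˣ (ZMod 2) ≃+ ZMod 2 × ZMod 2) ∧
    Nonempty (AddSubgroup.torsionBy (contH2 Dˣ (Additive ℂˣ)) 2 ≃+ ZMod 2) := by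
  have := finite_residueRing hW hcomp
  have hcompact : CompactSpace (principalUnits W) :=
    isCompact_iff_compactSpace.1 (isCompact_principalUnits hW hcomp)
  have hopen : IsOpen (principalUnits W : Set Dˣ) := isOpen_congruenceUnits hW 1
  have hN := hasCoprimeIndexBasis_principalUnits hW Nat.prime_two (by exact_mod_cast h2)
  obtain ⟨r, π, hπ, hker⟩ := exists_surjective_cyclicByInt_ker_eq W
  rw [← hker] at hcompact hopen hN
  have hn : Nat.card (ResidueRing W)ˣ ≠ 0 := Nat.card_pos.ne'
  have h2n := two_dvd_card_units_residueRing W h2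
  have hr : ZMod.unitsMap h2n r = 1 := Subsingleton.elim _ _
  exact ⟨nonempty_contH2_zmod_addEquiv hπ hopen hN hn h2n hr,
    nonempty_torsionBy_contH2_complexUnits_addEquiv hπ hopen hN hn h2n hr⟩

end Topology

end ValuedDivisionRing

section ModuleTopology

variable (R A : Type*) [CommRing R] [TopologicalSpace R] [IsTopologicalRing R] [Ring A]
  [Algebra R A] [Module.Free R A] [Module.Finite R A] [TopologicalSpace A] [IsModuleTopology R A]

theorem nonempty_continuousLinearEquiv_pi :
    Nonempty (A ≃L[R] (Module.Free.ChooseBasisIndex R A → R)) := by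
  have := IsModuleTopology.toContinuousAdd R A
  let e := (Module.Free.chooseBasis R A).equivFun
  exact ⟨{ e with
    continuous_toFun := IsModuleTopology.continuous_of_linearMap e.toLinearMap
    continuous_invFun := IsModuleTopology.continuous_of_linearMap e.symm.toLinearMap }⟩

theorem t2Space_of_isModuleTopology [T2Space R] : T2Space A := by
  obtain ⟨e⟩ := nonempty_continuousLinearEquiv_pi R A
  exact e.toHomeomorph.isEmbedding.t2Space

theorem continuous_norm_of_isModuleTopology : Continuous (Algebra.norm R : A → R) := by
  let b := Module.Free.chooseBasis R A
  have hb : Continuous (Algebra.leftMulMatrix b) :=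
    IsModuleTopology.continuous_of_linearMap (Algebra.leftMulMatrix b).toLinearMap
  exact (funext (Algebra.norm_eq_matrix_det b) : ⇑(Algebra.norm R) = _) ▸ hb.matrix_det

end ModuleTopology

open ValuativeRel

theorem valuation_two_eq_one {F : Type*} [Field F] [ValuativeRel F] (hodd : Odd (ringChar 𝓀[F])) :
    valuation F 2 = 1 := by
  have h2 : IsLocalRing.residue 𝒪[F] 2 ≠ 0 := by
    rw [map_ofNat]
    exact Ring.two_ne_zero fun h => Nat.not_odd_iff_even.2 even_two (h ▸ hodd)
  have hunit : IsUnit (2 : 𝒪[F]) := (IsLocalRing.residue_ne_zero_iff_isUnit _).1 h2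
  rw [← map_ofNat (algebraMap 𝒪[F] F)]
  exact (Valuation.integer.integers (valuation F)).isUnit_iff_valuation_eq_one.1 hunit

section ValuativeTopology

variable {F : Type*} [Field F] [ValuativeRel F] [TopologicalSpace F] [IsValuativeTopology F]

theorem isOpen_valuation_lt (γ : ValueGroupWithZero F) : IsOpen {x : F | valuation F x < γ} := by
  obtain ⟨y, rfl⟩ := valuation_surjective γ
  simp_rw [← (valuation F).restrict_lt_iff]
  exact Valuation.isOpen_ball _

theorem isClosed_valuation_le (γ : ValueGroupWithZero F) :
    IsClosed {x : F | valuation F x ≤ γ} := by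
  obtain ⟨y, rfl⟩ := valuation_surjective γ
  simp_rw [← (valuation F).restrict_le_iff]
  exact Valuation.isClosed_closedBall _

variable (F) in
theorem t2Space_of_isValuativeTopology : T2Space F :=
  IsTopologicalAddGroup.t2Space_of_zero_sep fun x hx =>
    ⟨{y | valuation F y < valuation F x}, (isOpen_valuation_lt _).mem_nhds
      (by simpa [zero_lt_iff] using hx), fun h => lt_irrefl (valuation F x) h⟩

theorem tendsto_pow_nhds_zero_of_valuation_lt_one [MulArchimedean (ValueGroupWithZero F)] {a : F}
    (ha : valuation F a < 1) : Tendsto (fun k : ℕ => a ^ k) atTop (𝓝 0) := by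
  refine (IsValuativeTopology.hasBasis_nhds_zero F).tendsto_right_iff.2 fun γ _ => ?_
  obtain ⟨k, hk⟩ := exists_pow_lt₀ ha γ
  filter_upwards [eventually_ge_atTop k] with j hj
  rw [map_pow]
  exact (pow_le_pow_right_of_le_one' ha.le hj).trans_lt hk

end ValuativeTopology

theorem le_one_of_forall_pow_le {Γ : Type*} [LinearOrderedCommGroupWithZero Γ] [MulArchimedean Γ]
    {x : Γ} {γ : Γˣ} (h : ∀ k : ℕ, x ^ k ≤ γ) : x ≤ 1 := by
  by_contra! hx
  obtain ⟨k, hk⟩ := exists_pow_lt₀ (inv_lt_one_of_one_lt₀ hx) γ⁻¹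
  rw [inv_pow, Units.val_inv_eq_inv_val,
    inv_lt_inv₀ (pow_pos (zero_lt_one.trans hx) k) (zero_lt_iff.2 γ.ne_zero)] at hk
  exact hk.not_ge (h k)

section NormValuation

variable (F D : Type*) [Field F] [ValuativeRel F] [DivisionRing D] [Algebra F D]
  [Module.Finite F D]

/-- The valuation of the norm of a finite-dimensional division algebra. Over a local field it is a
valuation, see `divisionValuation`. -/
noncomputable def normVal : D →*₀ ValueGroupWithZero F where
  toFun x := valuation F (Algebra.norm F x)
  map_zero' := by rw [Algebra.norm_zero, map_zero]
  map_one' := by rw [map_one, map_one]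
  map_mul' x y := by rw [map_mul, map_mul]

variable {D}

theorem normVal_smul (c : F) (x : D) :
    normVal F D (c • x) = valuation F c ^ Module.finrank F D * normVal F D x := by
  have hc : normVal F D (algebraMap F D c) = valuation F c ^ Module.finrank F D :=
    (congrArg (valuation F) (Algebra.norm_algebraMap c)).trans (map_pow _ _ _)
  rw [Algebra.smul_def, map_mul, hc]

theorem normVal_smul_le {c : F} (hc : valuation F c ≤ 1) (x : D) :
    normVal F D (c • x) ≤ valuation F c * normVal F D x := by
  rw [normVal_smul]
  gcongr
  exact pow_le_of_le_one zero_le hc Module.finrank_pos.ne'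

variable [TopologicalSpace F] [IsNonarchimedeanLocalField F] [TopologicalSpace D]
  [IsModuleTopology F D]

theorem isOpen_normVal_lt (γ : ValueGroupWithZero F) : IsOpen {x : D | normVal F D x < γ} :=
  (isOpen_valuation_lt γ).preimage (continuous_norm_of_isModuleTopology F D)

theorem isClosed_normVal_le (γ : ValueGroupWithZero F) : IsClosed {x : D | normVal F D x ≤ γ} :=
  (isClosed_valuation_le γ).preimage (continuous_norm_of_isModuleTopology F D)

theorem exists_le_normVal {K : Set D} (hK : IsCompact K) (h0 : (0 : D) ∉ K) :
    ∃ γ : (ValueGroupWithZero F)ˣ, ∀ x ∈ K, γ ≤ normVal F D x := by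
  have := t2Space_of_isValuativeTopology F
  have himage : IsCompact (Algebra.norm F '' K) :=
    hK.image (continuous_norm_of_isModuleTopology F D)
  have hnhds : (Algebra.norm F '' K)ᶜ ∈ 𝓝 (0 : F) := by
    refine himage.isClosed.isOpen_compl.mem_nhds ?_
    rintro ⟨x, hx, hx0⟩
    exact h0 (Algebra.norm_eq_zero_iff.1 hx0 ▸ hx)
  obtain ⟨γ, -, hγ⟩ := (IsValuativeTopology.hasBasis_nhds_zero F).mem_iff.1 hnhds
  exact ⟨γ, fun x hx => not_lt.1 fun h => hγ h ⟨x, hx, rfl⟩⟩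

theorem exists_normVal_lt {K : Set D} (hK : IsCompact K) :
    ∃ γ : (ValueGroupWithZero F)ˣ, ∀ x ∈ K, normVal F D x < γ := by
  have hcover (x : D) : ∃ γ : (ValueGroupWithZero F)ˣ, normVal F D x < γ := by
    rcases eq_or_ne (normVal F D x) 0 with hx | hx
    · exact ⟨1, by simp [hx]⟩
    · have : Nontrivial (ValueGroupWithZero F)ˣ :=
        isNontrivial_iff_nontrivial_units.1 inferInstance
      exact exists_gt (Units.mk0 _ hx)
  have hmono : Monotone fun γ : (ValueGroupWithZero F)ˣ => {x : D | normVal F D x < γ} :=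
    fun γ δ hγδ x hx => lt_of_lt_of_le hx (Units.val_le_val.2 hγδ)
  exact hK.elim_directed_cover _ (fun γ => isOpen_normVal_lt F _)
    (fun x _ => Set.mem_iUnion.2 (hcover x)) hmono.directed_le

variable (D) in
include F in
theorem exists_isOpen_isCompact_addSubgroup :
    ∃ L : AddSubgroup D, IsOpen (L : Set D) ∧ IsCompact (L : Set D) := by
  obtain ⟨e⟩ := nonempty_continuousLinearEquiv_pi F D
  let M : AddSubgroup (Module.Free.ChooseBasisIndex F D → F) :=
    AddSubgroup.pi Set.univ fun _ => 𝒪[F].toAddSubgroup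
  have hMo : IsOpen (M : Set (Module.Free.ChooseBasisIndex F D → F)) :=
    isOpen_set_pi Set.finite_univ fun _ _ => Valuation.isOpen_integer
  have hMc : IsCompact (M : Set (Module.Free.ChooseBasisIndex F D → F)) :=
    isCompact_univ_pi fun _ => IsNonarchimedeanLocalField.isCompact_closedBall F 1
  exact ⟨M.comap e.toLinearMap.toAddMonoidHom, hMo.preimage e.continuous,
    e.toHomeomorph.isCompact_preimage.2 hMc⟩

/-- The points of `a⁻¹ • L \ L` have norm bounded below, and every point outside `L` is moved
into this annulus by a power of `a`, which only decreases its norm. -/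
theorem exists_normVal_lt_subset_of_isCompact {L : Set D} (hLo : IsOpen L) (hLc : IsCompact L)
    (h0 : 0 ∈ L) : ∃ γ : (ValueGroupWithZero F)ˣ, {x | normVal F D x < γ} ⊆ L := by
  obtain ⟨a, ha0, ha⟩ := Valuation.IsNontrivial.exists_lt_one (v := valuation F)
  have hannulus : IsCompact ((fun x => a • x) ⁻¹' L \ L) :=
    ((Homeomorph.smulOfNeZero a ha0).isCompact_preimage.2 hLc).diff hLo
  obtain ⟨γ, hγ⟩ := exists_le_normVal F hannulus fun h => h.2 h0
  refine ⟨γ, fun x hx => by_contra fun hxL => ?_⟩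
  have htendsto : Tendsto (fun k : ℕ => a ^ k • x) atTop (𝓝 0) := by
    simpa using (tendsto_pow_nhds_zero_of_valuation_lt_one ha).smul_const x
  obtain ⟨k, hk, hk'⟩ : ∃ k : ℕ, a ^ k • x ∉ L ∧ a ^ (k + 1) • x ∈ L := by
    by_contra! h
    have hnot (k : ℕ) : a ^ k • x ∉ L := by
      induction k with
      | zero => simpa using hxL
      | succ k ih => exact h k ih
    exact (htendsto.eventually (hLo.mem_nhds h0)).exists.elim hnot
  have hle : normVal F D (a ^ k • x) ≤ normVal F D x := by
    have hak : valuation F (a ^ k) ≤ 1 := (map_pow _ _ _).trans_le (pow_le_one' ha.le k)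
    exact (normVal_smul_le F hak x).trans (mul_le_of_le_one_left' hak)
  rw [pow_succ', mul_smul] at hk'
  exact ((hγ _ ⟨hk', hk⟩).trans hle).not_gt hx

theorem hasBasis_nhds_zero_normVal :
    (𝓝 (0 : D)).HasBasis (fun _ : (ValueGroupWithZero F)ˣ => True)
      fun γ => {x | normVal F D x < γ} := by
  refine hasBasis_iff.2 fun U => ⟨fun hU => ?_, fun ⟨γ, _, hγ⟩ => mem_of_superset
    ((isOpen_normVal_lt F _).mem_nhds (by simp [zero_lt_iff])) hγ⟩
  obtain ⟨V, hVU, hVo, hV0⟩ := mem_nhds_iff.1 hU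
  obtain ⟨L, hLo, hLc⟩ := exists_isOpen_isCompact_addSubgroup F D
  obtain ⟨γ, hγ⟩ := exists_normVal_lt_subset_of_isCompact F hLo hLc L.zero_mem
  obtain ⟨δ, hδ⟩ := exists_le_normVal F (hLc.diff hVo) fun h => h.2 hV0
  refine ⟨min γ δ, trivial, fun x hx => hVU (by_contra fun hxV => ?_)⟩
  rw [Set.mem_ofPred_eq, Units.min_val, lt_min_iff] at hx
  exact (hδ x ⟨hγ hx.1, hxV⟩).not_gt hx.2

theorem exists_smul_mem_of_normVal_le {L : Set D} (hLo : IsOpen L) (hLc : IsCompact L)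
    (h0 : 0 ∈ L) (γ : (ValueGroupWithZero F)ˣ) :
    ∃ c : F, c ≠ 0 ∧ ∀ x : D, normVal F D x ≤ γ → c • x ∈ L := by
  obtain ⟨δ, hδ⟩ := exists_normVal_lt_subset_of_isCompact F hLo hLc h0
  obtain ⟨a, ha0, ha⟩ := Valuation.IsNontrivial.exists_lt_one (v := valuation F)
  obtain ⟨k, hk⟩ := exists_pow_lt₀ ha (δ / γ)
  rw [← map_pow, Units.val_div_eq_div_val, lt_div_iff₀ (zero_lt_iff.2 γ.ne_zero)] at hk
  have hak : valuation F (a ^ k) ≤ 1 := (map_pow _ _ _).trans_le (pow_le_one' ha.le k)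
  refine ⟨a ^ k, pow_ne_zero k ha0, fun x hx => hδ ?_⟩
  exact ((normVal_smul_le F hak x).trans (mul_le_mul_right hx _)).trans_lt hk

theorem isCompact_normVal_le (γ : (ValueGroupWithZero F)ˣ) :
    IsCompact {x : D | normVal F D x ≤ γ} := by
  obtain ⟨L, hLo, hLc⟩ := exists_isOpen_isCompact_addSubgroup F D
  obtain ⟨c, hc, hcL⟩ := exists_smul_mem_of_normVal_le F hLo hLc L.zero_mem γ
  exact ((Homeomorph.smulOfNeZero c hc).isCompact_preimage.2 hLc).of_isClosed_subset
    (isClosed_normVal_le F _) hcL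

/-- The additive subgroup generated by the elements of norm at most `1` is bounded, and it is
a subring since these elements form a monoid; so the powers of `1 + x` are bounded. -/
theorem normVal_one_add_le {x : D} (hx : normVal F D x ≤ 1) : normVal F D (1 + x) ≤ 1 := by
  obtain ⟨L, hLo, hLc⟩ := exists_isOpen_isCompact_addSubgroup F D
  obtain ⟨c, hc, hcL⟩ := exists_smul_mem_of_normVal_le F hLo hLc L.zero_mem 1
  obtain ⟨γ, hγ⟩ := exists_normVal_lt F ((Homeomorph.smulOfNeZero c hc).isCompact_preimage.2 hLc)
  let S : Submonoid D :=
    { carrier := {y | normVal F D y ≤ 1}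
      one_mem' := (map_one (normVal F D)).le
      mul_mem' hy hz := (map_mul (normVal F D) _ _).trans_le (mul_le_one' hy hz) }
  have hS : AddSubgroup.closure (S : Set D) ≤ L.comap (DistribSMul.toAddMonoidHom D c) :=
    (AddSubgroup.closure_le _).2 fun y hy => hcL y hy
  have hmem : 1 + x ∈ Subring.closure (S : Set D) :=
    add_mem (one_mem _) (Subring.subset_closure hx)
  refine le_one_of_forall_pow_le fun k => (map_pow (normVal F D) _ k).ge.trans (hγ _ (hS ?_)).le
  simpa only [Subring.mem_closure_iff, Submonoid.closure_eq] using pow_mem hmem k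

variable (D) in
/-- The valuation of a finite-dimensional division algebra over a local field. -/
noncomputable def divisionValuation : Valuation D (ValueGroupWithZero F) where
  __ := normVal F D
  map_add_le_max' x y := by
    change normVal F D (x + y) ≤ max (normVal F D x) (normVal F D y)
    wlog hxy : normVal F D x ≤ normVal F D y generalizing x y
    · rw [add_comm, max_comm]
      exact this y x (le_of_not_ge hxy)
    rcases eq_or_ne y 0 with rfl | hy
    · simp
    have hle : normVal F D (x * y⁻¹) ≤ 1 := by
      rw [map_mul, map_inv₀]
      exact mul_inv_le_one_of_le₀ hxy zero_le
    have hadd : x + y = (1 + x * y⁻¹) * y := by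
      rw [add_mul, one_mul, inv_mul_cancel_right₀ hy, add_comm]
    rw [max_eq_right hxy, hadd, map_mul]
    exact mul_le_of_le_one_left' (normVal_one_add_le F hle)

variable (D) in
theorem divisionValuation_algebraMap (c : F) :
    divisionValuation F D (algebraMap F D c) = valuation F c ^ Module.finrank F D := by
  rw [Algebra.algebraMap_eq_smul_one]
  exact (normVal_smul F c 1).trans (by rw [map_one, mul_one])

instance : (divisionValuation F D).IsNontrivial where
  exists_val_nontrivial := by
    obtain ⟨a, ha0, ha⟩ := Valuation.IsNontrivial.exists_lt_one (v := valuation F)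
    refine ⟨algebraMap F D a, by simpa using ha0, ?_⟩
    rw [divisionValuation_algebraMap]
    exact (pow_lt_one₀ zero_le ha Module.finrank_pos.ne').ne

end NormValuation

theorem proposition4p3_general
    {F : Type*} [Field F] [ValuativeRel F] [TopologicalSpace F] [IsNonarchimedeanLocalField F]
    (hodd : Odd (ringChar 𝓀[F]))
    {D : Type*} [DivisionRing D] [Algebra F D] [Module.Finite F D]
    [TopologicalSpace D] [IsTopologicalRing D] [IsModuleTopology F D] :
    Nonempty (contH2 Dˣ (ZMod 2) ≃+ ZMod 2 × ZMod 2) ∧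
    Nonempty (AddSubgroup.torsionBy (contH2 Dˣ (Additive ℂˣ)) 2 ≃+ ZMod 2) := by
  have := t2Space_of_isValuativeTopology F
  have := t2Space_of_isModuleTopology F D
  have h2 : divisionValuation F D 2 = 1 := by
    rw [← map_ofNat (algebraMap F D), divisionValuation_algebraMap, valuation_two_eq_one hodd,
      one_pow]
  exact nonempty_contH2_units_addEquiv_of_valuation (W := divisionValuation F D)
    (hasBasis_nhds_zero_normVal F) (isCompact_normVal_le F 1) h2

theorem proposition4p3
    {F : Type*} [Field F] [ValuativeRel F] [TopologicalSpace F] [IsNonarchimedeanLocalField F]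
    (hodd : Odd (ringChar 𝓀[F]))
    {D : Type*} [DivisionRing D] [Algebra F D] [Algebra.IsCentral F D]
    (hdim : Module.finrank F D = 4)
    [TopologicalSpace D] [IsTopologicalRing D] [IsModuleTopology F D] :
    Nonempty (contH2 Dˣ (ZMod 2) ≃+ ZMod 2 × ZMod 2) ∧
    Nonempty (AddSubgroup.torsionBy (contH2 Dˣ (Additive ℂˣ)) 2 ≃+ ZMod 2) :=
  have : Module.Finite F D := Module.finite_of_finrank_pos (by omega)
  proposition4p3_general hodd
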